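/- Let $\phi\ge 1$ and consider the linear time-varying system $x(k+1)=A(k)x(k)+B(k)u(k)$, $k\ge 0$, with $x(k)\in\mathbb{R}^n$, $u(k)\in\mathbb{R}^m$, and weights $Q(k)=Q(k)^\top\succeq 0$, $R(k)=R(k)^\top\succ 0$, all $\phi$-periodic: $A(k+\phi)=A(k)$, $B(k+\phi)=B(k)$, $Q(k+\phi)=Q(k)$, $R(k+\phi)=R(k)$ for all $k\ge 0$. Assume that $(A,B)$ is stabilisable (there is a bounded sequence $F(k)$ such that $x(k+1)=(A(k)+B(k)F(k))x(k)$ is exponentially stable) and that $(A,Q^{1/2})$ is detectable (there is a bounded sequence $F(k)$ such that $x(k+1)=(A(k)+F(k)Q(k)^{1/2})x(k)$ is exponentially stable). Exponential stability is uniform in the initial time. Let input-state data $x_{d,j}(0),\dots,x_{d,j}(\phi)$ and $u_{d,j}(0),\dots,u_{d,j}(\phi-1)$, $j=1,\dots,L$, be given with $x_{d,j}(k+1)=A(k)x_{d,j}(k)+B(k)u_{d,j}(k)$ for $0\le k<\phi$. Put $X(k)=[x_{d,1}(k),\dots,x_{d,L}(k)]$ and $U(k)=[u_{d,1}(k),\dots,u_{d,L}(k)]$,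 and suppose that $\operatorname{rank}\begin{bmatrix}X(k)\\U(k)\end{bmatrix}=n+m$ for $k=0,\dots,\phi-1$. Consider the semidefinite programme in the variables $S(0),\dots,S(\phi)\in\mathbb{R}^{n\times n}$, $H(0),\dots,H(\phi-1)\in\mathbb{R}^{L\times n}$, $O(0),\dots,O(\phi-1)\in\mathbb{R}^{m\times m}$: $$\min_{S,H,O}\ \sum_{k=0}^{\phi-1}\bigl(\operatorname{Tr}(Q(k)S(k))+\operatorname{Tr}(O(k))\bigr)$$ subject to $S(0)\succeq I_n$, $S(\phi)=S(0)$ and, for $k=0,\dots,\phi-1$, $$\begin{bmatrix}S(k+1)-I_n & X(k+1)H(k)\\ H(k)^\top X(k+1)^\top & S(k)\end{bmatrix}\succeq 0,\qquad \begin{bmatrix}O(k) & R(k)^{1/2}U(k)H(k)\\ H(k)^\top U(k)^\top R(k)^{1/2} & S(k)\end{bmatrix}\succeq 0,\qquad S(k)=X(k)H(k).$$ Then this programme has an optimal solution. For every optimal solution $(S^*,H^*,O^*)$ the matrices $S^*(k)$ are invertible, and the gain sequence defined by $K^*(k)=U(k)H^*(k)S^*(k)^{-1}$ for $k=0,\dots,\phi-1$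 and $K^*(k+n_p\phi)=K^*(k)$ for all $k,n_p\ge 0$ is the unique optimal gain sequence of the infinite-horizon LQR problem. That is, $K^*$ is the unique sequence $K(k)$, $k\ge 0$, such that $x(k+1)=(A(k)+B(k)K(k))x(k)$ is exponentially stable and, for every initial time $k_0\ge 0$ and every initial state $x(k_0)$, the law $u(k)=K(k)x(k)$ has finite cost $\sum_{k\ge k_0}\bigl(x(k)^\top Q(k)x(k)+u(k)^\top R(k)u(k)\bigr)$, which is minimal among all input sequences. In particular, the optimal gain sequence is $\phi$-periodic. -/

import Mathlib

open scoped Matrix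

namespace LTV

/-- Periodicity of a sequence indexed by `k ≥ 0`, with period `φ`. -/
def PeriodicSeq {α : Type*} (φ : ℕ) (M : ℕ → α) : Prop :=
  ∀ k, M (k + φ) = M k

/-- Boundedness of a sequence of real matrices. -/
def BoundedSeq {p q : ℕ} (M : ℕ → Matrix (Fin p) (Fin q) ℝ) : Prop :=
  ∃ b : ℝ, ∀ k i j, |M k i j| ≤ b

/-- The state of `x(k+1) = A(k) x(k) + B(k) u(k)` at time `k₀ + i`, when the state at time `k₀`
is `x₀` and the input applied at time `k₀ + i` is `u i`. -/
def state {n m : ℕ} (A : ℕ → Matrix (Fin n) (Fin n) ℝ) (B : ℕ → Matrix (Fin n) (Fin m) ℝ)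
    (k₀ : ℕ) (x₀ : Fin n → ℝ) (u : ℕ → Fin m → ℝ) : ℕ → Fin n → ℝ
  | 0 => x₀
  | i + 1 => A (k₀ + i) *ᵥ state A B k₀ x₀ u i + B (k₀ + i) *ᵥ u i

/-- The state of the autonomous system `x(k+1) = F(k) x(k)` at time `k₀ + i`, when the state at
time `k₀` is `x₀`. -/
def freeState {n : ℕ} (F : ℕ → Matrix (Fin n) (Fin n) ℝ) (k₀ : ℕ) (x₀ : Fin n → ℝ) :
    ℕ → Fin n → ℝ
  | 0 => x₀
  | i + 1 => F (k₀ + i) *ᵥ freeState F k₀ x₀ i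

/-- (Uniform) exponential stability of `x(k+1) = F(k) x(k)`, `k ≥ 0`, in the Euclidean norm. -/
def ExpStable {n : ℕ} (F : ℕ → Matrix (Fin n) (Fin n) ℝ) : Prop :=
  ∃ c r : ℝ, 0 < c ∧ 0 < r ∧ r < 1 ∧ ∀ (k₀ : ℕ) (x₀ : Fin n → ℝ) (i : ℕ),
    ‖WithLp.toLp 2 (freeState F k₀ x₀ i)‖ ≤ c * r ^ i * ‖WithLp.toLp 2 x₀‖

/-- The closed-loop dynamics matrices `A(k) + B(k) K(k)`. -/
def closedLoop {n m : ℕ} (A : ℕ → Matrix (Fin n) (Fin n) ℝ) (B : ℕ → Matrix (Fin n) (Fin m) ℝ)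
    (K : ℕ → Matrix (Fin m) (Fin n) ℝ) : ℕ → Matrix (Fin n) (Fin n) ℝ :=
  fun k => A k + B k * K k

/-- Stabilisability of the time-varying pair `(A, B)`. -/
def Stabilisable {n m : ℕ} (A : ℕ → Matrix (Fin n) (Fin n) ℝ)
    (B : ℕ → Matrix (Fin n) (Fin m) ℝ) : Prop :=
  ∃ K : ℕ → Matrix (Fin m) (Fin n) ℝ, BoundedSeq K ∧ ExpStable (closedLoop A B K)

/-- Detectability of the time-varying pair `(A, C)`, with output `C(k) x(k)`. -/
def Detectable {n p : ℕ} (A : ℕ → Matrix (Fin n) (Fin n) ℝ)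
    (C : ℕ → Matrix (Fin p) (Fin n) ℝ) : Prop :=
  ∃ F : ℕ → Matrix (Fin n) (Fin p) ℝ, BoundedSeq F ∧ ExpStable (fun k => A k + F k * C k)

section Sqrt

open scoped MatrixOrder

/-- The positive semidefinite square root of a positive semidefinite real matrix. -/
noncomputable def sqrtMat {p : ℕ} (M : Matrix (Fin p) (Fin p) ℝ) : Matrix (Fin p) (Fin p) ℝ :=
  CFC.sqrt M

end Sqrt

/-- The infinite-horizon cost, from time `k₀` on, of the input sequence `u` for the state `x₀`
at time `k₀`, with values in `[0, ∞]`. For `k₀ = 0` it is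
`∑_{k ≥ 0} x(k)ᵀ Q(k) x(k) + u(k)ᵀ R(k) u(k)` with `x(0) = x₀`. -/
noncomputable def cost {n m : ℕ} (A : ℕ → Matrix (Fin n) (Fin n) ℝ)
    (B : ℕ → Matrix (Fin n) (Fin m) ℝ) (Q : ℕ → Matrix (Fin n) (Fin n) ℝ)
    (R : ℕ → Matrix (Fin m) (Fin m) ℝ) (k₀ : ℕ) (x₀ : Fin n → ℝ) (u : ℕ → Fin m → ℝ) :
    ENNReal :=
  ∑' i : ℕ, ENNReal.ofReal
    (state A B k₀ x₀ u i ⬝ᵥ Q (k₀ + i) *ᵥ state A B k₀ x₀ u i + u i ⬝ᵥ R (k₀ + i) *ᵥ u i)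

/-- The input sequence generated from time `k₀` and state `x₀` by the law `u(k) = K(k) x(k)`. -/
def feedbackInput {n m : ℕ} (A : ℕ → Matrix (Fin n) (Fin n) ℝ)
    (B : ℕ → Matrix (Fin n) (Fin m) ℝ) (K : ℕ → Matrix (Fin m) (Fin n) ℝ)
    (k₀ : ℕ) (x₀ : Fin n → ℝ) : ℕ → Fin m → ℝ :=
  fun i => K (k₀ + i) *ᵥ freeState (closedLoop A B K) k₀ x₀ i

/-- `K` is an optimal gain sequence of the infinite-horizon LQR problem: it is stabilising and,
for every initial time and initial state, the law `u(k) = K(k) x(k)` has finite cost, which is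
minimal among all input sequences. -/
def IsOptimalGain {n m : ℕ} (A : ℕ → Matrix (Fin n) (Fin n) ℝ)
    (B : ℕ → Matrix (Fin n) (Fin m) ℝ) (Q : ℕ → Matrix (Fin n) (Fin n) ℝ)
    (R : ℕ → Matrix (Fin m) (Fin m) ℝ) (K : ℕ → Matrix (Fin m) (Fin n) ℝ) : Prop :=
  ExpStable (closedLoop A B K) ∧
    ∀ (k₀ : ℕ) (x₀ : Fin n → ℝ),
      cost A B Q R k₀ x₀ (feedbackInput A B K k₀ x₀) < ⊤ ∧
      ∀ u : ℕ → Fin m → ℝ,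
        cost A B Q R k₀ x₀ (feedbackInput A B K k₀ x₀) ≤ cost A B Q R k₀ x₀ u

/-- The data matrix at time `k`, whose `j`-th column is the sample at time `k` of the `j`-th
experiment. -/
def dataMatrix {p L : ℕ} (z : Fin L → ℕ → Fin p → ℝ) (k : ℕ) : Matrix (Fin p) (Fin L) ℝ :=
  Matrix.of fun i j => z j k i

/-- Feasibility for the data-dependent semidefinite programme over one period. Only the
values `S(0), …, S(φ)`, `H(0), …, H(φ-1)` and `O(0), …, O(φ-1)` matter. -/
structure SDPFeasible {n m L : ℕ} (φ : ℕ) (X : ℕ → Matrix (Fin n) (Fin L) ℝ)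
    (U : ℕ → Matrix (Fin m) (Fin L) ℝ) (R : ℕ → Matrix (Fin m) (Fin m) ℝ)
    (S : ℕ → Matrix (Fin n) (Fin n) ℝ) (H : ℕ → Matrix (Fin L) (Fin n) ℝ)
    (O : ℕ → Matrix (Fin m) (Fin m) ℝ) : Prop where
  init : (S 0 - 1).PosSemidef
  dyn : ∀ k < φ, (Matrix.fromBlocks (S (k + 1) - 1) (X (k + 1) * H k)
    ((H k)ᵀ * (X (k + 1))ᵀ) (S k)).PosSemidef
  slack : ∀ k < φ, (Matrix.fromBlocks (O k) (sqrtMat (R k) * U k * H k)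
    ((H k)ᵀ * (U k)ᵀ * sqrtMat (R k)) (S k)).PosSemidef
  eq : ∀ k < φ, S k = X k * H k
  periodic : S φ = S 0

/-- The objective of the semidefinite programme. -/
def sdpObjective {n m : ℕ} (φ : ℕ) (Q : ℕ → Matrix (Fin n) (Fin n) ℝ)
    (S : ℕ → Matrix (Fin n) (Fin n) ℝ) (O : ℕ → Matrix (Fin m) (Fin m) ℝ) : ℝ :=
  ∑ k ∈ Finset.range φ, ((Q k * S k).trace + (O k).trace)

/-- `(S, H, O)` is an optimal solution of the semidefinite programme. -/
def IsSDPSolution {n m L : ℕ} (φ : ℕ) (X : ℕ → Matrix (Fin n) (Fin L) ℝ)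
    (U : ℕ → Matrix (Fin m) (Fin L) ℝ) (Q : ℕ → Matrix (Fin n) (Fin n) ℝ)
    (R : ℕ → Matrix (Fin m) (Fin m) ℝ)
    (S : ℕ → Matrix (Fin n) (Fin n) ℝ) (H : ℕ → Matrix (Fin L) (Fin n) ℝ)
    (O : ℕ → Matrix (Fin m) (Fin m) ℝ) : Prop :=
  SDPFeasible φ X U R S H O ∧
    ∀ S' H' O', SDPFeasible φ X U R S' H' O' → sdpObjective φ Q S O ≤ sdpObjective φ Q S' O'

end LTV

/-! A periodic solution P of the Riccati equation serves twice: its quadratic form is the value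
function of the LQR problem, and it is a dual certificate for the semidefinite programme. Both uses
rest on completing the square (`completion_of_squares`): a step with gain K costs the Riccati update
plus a term (K - G)ᵀ W (K - G), where G is the Riccati gain and W is positive definite.

P is the limit of value iteration from zero (`exists_riccati_solution`): the iterates increase,
stabilisability bounds them, and periodicity survives the limit. Detectability makes G stabilising
(`expStable_closedLoop`). Summing the squares along a trajectory (`finiteCost_add_eq`) shows that G
is optimal and that no other stabilising gain is.

For the programme, the rank condition makes the data represent every pair (S, K S) as (X H, U H).
Schur complements turn the constraints into S(k+1) ⪰ I + F S(k) Fᵀ, with F the closed-loop matrix,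
and O ⪰ R^{1/2} K S Kᵀ R^{1/2}. Pairing the first with P(k+1) and telescoping over a period bounds
the objective below by ∑ tr P(k+1) plus traces of the squares (`SDPFeasible.objective_ge`). The
periodic covariance of the Riccati loop attains ∑ tr P(k+1) (`exists_sdpFeasible`). So at any
optimum the squares vanish and the gain is G. -/

namespace LTV

open Matrix Filter Topology

/-! ### Positive semidefinite matrices and one step of dynamic programming. -/

section Algebra

variable {n m : ℕ}

theorem quad_nonneg {ι : Type*} [Fintype ι] {M : Matrix ι ι ℝ} (h : M.PosSemidef) (x : ι → ℝ) :
    0 ≤ x ⬝ᵥ M *ᵥ x := by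
  simpa using h.dotProduct_mulVec_nonneg x

theorem posSemidef_of_quad {ι : Type*} [Fintype ι] {M : Matrix ι ι ℝ} (hs : Mᵀ = M)
    (h : ∀ x, 0 ≤ x ⬝ᵥ M *ᵥ x) : M.PosSemidef :=
  .of_dotProduct_mulVec_nonneg (by simpa [IsHermitian] using hs) (by simpa using h)

theorem transpose_eq_of_posSemidef {ι : Type*} {M : Matrix ι ι ℝ} (h : M.PosSemidef) :
    Mᵀ = M := by
  simpa [IsHermitian] using h.1

theorem posSemidef_conj {ι κ : Type*} [Fintype ι] [Fintype κ] {M : Matrix ι ι ℝ}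
    (h : M.PosSemidef) (C : Matrix ι κ ℝ) : (Cᵀ * M * C).PosSemidef := by
  simpa using h.conjTranspose_mul_mul_same C

theorem posSemidef_conj' {ι κ : Type*} [Fintype ι] [Fintype κ] {M : Matrix ι ι ℝ}
    (h : M.PosSemidef) (C : Matrix κ ι ℝ) : (C * M * Cᵀ).PosSemidef := by
  simpa using h.mul_mul_conjTranspose_same C

theorem sqrtMat_posSemidef {p : ℕ} (M : Matrix (Fin p) (Fin p) ℝ) : (sqrtMat M).PosSemidef := by
  open scoped MatrixOrder in
  exact nonneg_iff_posSemidef.1 (CFC.sqrt_nonneg M)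

theorem sqrtMat_mul_self {p : ℕ} {M : Matrix (Fin p) (Fin p) ℝ} (h : M.PosSemidef) :
    sqrtMat M * sqrtMat M = M := by
  open scoped MatrixOrder in
  exact CFC.sqrt_mul_sqrt_self M (nonneg_iff_posSemidef.2 h)

theorem sqrtMat_transpose {p : ℕ} (M : Matrix (Fin p) (Fin p) ℝ) : (sqrtMat M)ᵀ = sqrtMat M :=
  transpose_eq_of_posSemidef (sqrtMat_posSemidef M)

/-- By cyclicity the trace equals that of M^{1/2} N M^{1/2}. -/
theorem trace_mul_nonneg {p : ℕ} {M N : Matrix (Fin p) (Fin p) ℝ} (hM : M.PosSemidef)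
    (hN : N.PosSemidef) : 0 ≤ (M * N).trace := by
  have h : (M * N).trace = ((sqrtMat M)ᵀ * N * sqrtMat M).trace := by
    rw [sqrtMat_transpose, trace_mul_comm, mul_assoc, trace_mul_comm (sqrtMat M), mul_assoc,
      sqrtMat_mul_self hM]
  rw [h]
  exact (posSemidef_conj hN _).trace_nonneg

theorem quad_transpose_mul_mul {ι κ : Type*} [Fintype ι] [Fintype κ] (M : Matrix ι ι ℝ)
    (C : Matrix ι κ ℝ) (x : κ → ℝ) : x ⬝ᵥ (Cᵀ * M * C) *ᵥ x = (C *ᵥ x) ⬝ᵥ M *ᵥ (C *ᵥ x) := by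
  rw [← mulVec_mulVec, ← mulVec_mulVec, dotProduct_mulVec, vecMul_transpose]

/-- The weight on the input in one step of dynamic programming with terminal weight `P`. -/
def inputWeight (B : Matrix (Fin n) (Fin m) ℝ) (R : Matrix (Fin m) (Fin m) ℝ)
    (P : Matrix (Fin n) (Fin n) ℝ) : Matrix (Fin m) (Fin m) ℝ :=
  R + Bᵀ * P * B

/-- The minimising gain in one step of dynamic programming with terminal weight `P`. -/
noncomputable def riccatiGain (A : Matrix (Fin n) (Fin n) ℝ) (B : Matrix (Fin n) (Fin m) ℝ)
    (R : Matrix (Fin m) (Fin m) ℝ) (P : Matrix (Fin n) (Fin n) ℝ) : Matrix (Fin m) (Fin n) ℝ :=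
  -((inputWeight B R P)⁻¹ * (Bᵀ * P * A))

/-- The one-step cost matrix of the gain `K` with terminal weight `P`. -/
def stepCost (A : Matrix (Fin n) (Fin n) ℝ) (B : Matrix (Fin n) (Fin m) ℝ)
    (Q : Matrix (Fin n) (Fin n) ℝ) (R : Matrix (Fin m) (Fin m) ℝ) (P : Matrix (Fin n) (Fin n) ℝ)
    (K : Matrix (Fin m) (Fin n) ℝ) : Matrix (Fin n) (Fin n) ℝ :=
  Q + Kᵀ * R * K + (A + B * K)ᵀ * P * (A + B * K)

/-- The Riccati operator. -/
noncomputable def riccati (A : Matrix (Fin n) (Fin n) ℝ) (B : Matrix (Fin n) (Fin m) ℝ)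
    (Q : Matrix (Fin n) (Fin n) ℝ) (R : Matrix (Fin m) (Fin m) ℝ)
    (P : Matrix (Fin n) (Fin n) ℝ) : Matrix (Fin n) (Fin n) ℝ :=
  stepCost A B Q R P (riccatiGain A B R P)

theorem inputWeight_posDef (B : Matrix (Fin n) (Fin m) ℝ) {R : Matrix (Fin m) (Fin m) ℝ}
    {P : Matrix (Fin n) (Fin n) ℝ} (hR : R.PosDef) (hP : P.PosSemidef) :
    (inputWeight B R P).PosDef :=
  hR.add_posSemidef (posSemidef_conj hP B)

variable (A : Matrix (Fin n) (Fin n) ℝ) (B : Matrix (Fin n) (Fin m) ℝ)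
    {Q : Matrix (Fin n) (Fin n) ℝ} {R : Matrix (Fin m) (Fin m) ℝ} {P : Matrix (Fin n) (Fin n) ℝ}

theorem inputWeight_mul_riccatiGain (hR : R.PosDef) (hP : P.PosSemidef) :
    inputWeight B R P * riccatiGain A B R P = -(Bᵀ * P * A) := by
  have hu := (isUnit_iff_isUnit_det _).1 (inputWeight_posDef B hR hP).isUnit
  rw [riccatiGain, Matrix.mul_neg, mul_nonsing_inv_cancel_left _ _ hu]

theorem stepCost_posSemidef (hQ : Q.PosSemidef) (hR : R.PosDef) (hP : P.PosSemidef)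
    (K : Matrix (Fin m) (Fin n) ℝ) : (stepCost A B Q R P K).PosSemidef :=
  (hQ.add (posSemidef_conj hR.posSemidef K)).add (posSemidef_conj hP _)

/-- Completion of squares for a pair of matrices. -/
theorem completion_of_squares {p : Type} [Fintype p] (hR : R.PosDef)
    (hP : P.PosSemidef) (X : Matrix (Fin n) p ℝ) (V : Matrix (Fin m) p ℝ) :
    Xᵀ * Q * X + Vᵀ * R * V + (A * X + B * V)ᵀ * P * (A * X + B * V) =
      Xᵀ * riccati A B Q R P * X + (V - riccatiGain A B R P * X)ᵀ * inputWeight B R P *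
        (V - riccatiGain A B R P * X) := by
  have hg := inputWeight_mul_riccatiGain A B hR hP
  have hW := transpose_eq_of_posSemidef (inputWeight_posDef B hR hP).posSemidef
  -- Stated for arbitrary X and V because it is used twice: X = 1 with V the Riccati gain kills the
  -- square and identifies `riccati` in closed form; then the given X and V.
  have key : ∀ {q : Type} [Fintype q] (X : Matrix (Fin n) q ℝ) (V : Matrix (Fin m) q ℝ),
      Xᵀ * Q * X + Vᵀ * R * V + (A * X + B * V)ᵀ * P * (A * X + B * V) =
      Xᵀ * (Q + Aᵀ * P * A - (riccatiGain A B R P)ᵀ * inputWeight B R P * riccatiGain A B R P) * X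
       + (V - riccatiGain A B R P * X)ᵀ * inputWeight B R P * (V - riccatiGain A B R P * X) := by
    intro q _ X V
    have e2 : (riccatiGain A B R P)ᵀ * inputWeight B R P = -(Aᵀ * P * B) := by
      have := congrArg transpose hg
      rw [transpose_mul, hW] at this
      rw [this]
      simp [transpose_mul, transpose_eq_of_posSemidef hP, Matrix.mul_assoc]
    generalize riccatiGain A B R P = G at *
    have e3 : Xᵀ * Gᵀ * inputWeight B R P * V = -(Xᵀ * Aᵀ * P * B * V) := by
      rw [Matrix.mul_assoc Xᵀ, e2]; simp [Matrix.mul_assoc]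
    have e4 : Vᵀ * inputWeight B R P * G * X = -(Vᵀ * Bᵀ * P * A * X) := by
      rw [Matrix.mul_assoc Vᵀ, hg]; simp [Matrix.mul_assoc]
    have e5 : Vᵀ * inputWeight B R P * V = Vᵀ * R * V + Vᵀ * Bᵀ * P * B * V := by
      simp [inputWeight, Matrix.mul_add, Matrix.add_mul, Matrix.mul_assoc]
    simp only [transpose_add, transpose_sub, transpose_mul, Matrix.mul_add, Matrix.add_mul,
      Matrix.mul_sub, Matrix.sub_mul, ← Matrix.mul_assoc] at *
    rw [e3, e4, e5]
    abel
  have hr : riccati A B Q R P = Q + Aᵀ * P * A -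
      (riccatiGain A B R P)ᵀ * inputWeight B R P * riccatiGain A B R P := by
    have := key (1 : Matrix (Fin n) (Fin n) ℝ) (riccatiGain A B R P)
    simpa [riccati, stepCost] using this
  rw [hr]
  exact key X V

theorem stepCost_eq (hR : R.PosDef) (hP : P.PosSemidef) (K : Matrix (Fin m) (Fin n) ℝ) :
    stepCost A B Q R P K = riccati A B Q R P + (K - riccatiGain A B R P)ᵀ * inputWeight B R P *
      (K - riccatiGain A B R P) := by
  simpa [stepCost] using completion_of_squares A B (Q := Q) hR hP 1 K

theorem completion_of_squares_vec (hR : R.PosDef) (hP : P.PosSemidef) (x : Fin n → ℝ)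
    (u : Fin m → ℝ) :
    x ⬝ᵥ Q *ᵥ x + u ⬝ᵥ R *ᵥ u + (A *ᵥ x + B *ᵥ u) ⬝ᵥ P *ᵥ (A *ᵥ x + B *ᵥ u) =
      x ⬝ᵥ riccati A B Q R P *ᵥ x + (u - riccatiGain A B R P *ᵥ x) ⬝ᵥ inputWeight B R P *ᵥ
        (u - riccatiGain A B R P *ᵥ x) := by
  have h := completion_of_squares A B (Q := Q) hR hP (replicateCol Unit x) (replicateCol Unit u)
  have e : ∀ {q : ℕ} (M : Matrix (Fin q) (Fin q) ℝ) (z : Fin q → ℝ),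
      ((replicateCol Unit z)ᵀ * M * replicateCol Unit z) () () = z ⬝ᵥ M *ᵥ z := by
    intro q M z
    rw [Matrix.mul_assoc, ← replicateCol_mulVec]
    simp [Matrix.mul_apply, dotProduct]
  have h' := congrFun (congrFun h ()) ()
  have e1 : A * replicateCol Unit x + B * replicateCol Unit u =
      replicateCol Unit (A *ᵥ x + B *ᵥ u) := by
    simp only [← replicateCol_mulVec, ← replicateCol_add]
  have e2 : replicateCol Unit u - riccatiGain A B R P * replicateCol Unit x =
      replicateCol Unit (u - riccatiGain A B R P *ᵥ x) := by
    rw [← replicateCol_mulVec]; rfl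
  rw [e1, e2] at h'
  simp only [Matrix.add_apply, e] at h'
  exact h'

/-- Both sides are compared at the gain optimal for P', which is merely suboptimal for P. -/
theorem riccati_mono {P' : Matrix (Fin n) (Fin n) ℝ} (hR : R.PosDef) (hP : P.PosSemidef)
    (h : (P' - P).PosSemidef) :
    (riccati A B Q R P' - riccati A B Q R P).PosSemidef := by
  set K := riccatiGain A B R P' with hK
  have h1 : riccati A B Q R P' - stepCost A B Q R P K =
      (A + B * K)ᵀ * (P' - P) * (A + B * K) := by
    rw [riccati, ← hK, stepCost, stepCost, Matrix.mul_sub, Matrix.sub_mul]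
    abel
  have h2 := stepCost_eq A B (Q := Q) hR hP K
  have h3 : riccati A B Q R P' - riccati A B Q R P = (A + B * K)ᵀ * (P' - P) * (A + B * K) +
      (K - riccatiGain A B R P)ᵀ * inputWeight B R P * (K - riccatiGain A B R P) := by
    rw [← h1, h2]; abel
  rw [h3]
  exact (posSemidef_conj h _).add (posSemidef_conj (inputWeight_posDef B hR hP).posSemidef _)

theorem continuousAt_inv_of_posDef {M : Matrix (Fin m) (Fin m) ℝ} (h : M.PosDef) :
    ContinuousAt (fun N : Matrix (Fin m) (Fin m) ℝ => N⁻¹) M := by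
  refine continuousAt_matrix_inv M ?_
  simp only [Ring.inverse_eq_inv']
  exact continuousAt_inv₀ ((isUnit_iff_isUnit_det _).1 h.isUnit).ne_zero

/-- The inverted matrix is positive definite at P, so inversion is continuous there. This lets value
iteration pass to the limit. -/
theorem continuousAt_riccati (hR : R.PosDef) (hP : P.PosSemidef) :
    ContinuousAt (riccati A B Q R) P := by
  have hW : Continuous (inputWeight B R) := by unfold inputWeight; fun_prop
  have h1 : ContinuousAt (fun P => (inputWeight B R P)⁻¹) P :=
    ContinuousAt.comp (g := fun N : Matrix (Fin m) (Fin m) ℝ => N⁻¹)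
      (continuousAt_inv_of_posDef (inputWeight_posDef B hR hP)) hW.continuousAt
  have h2 : ContinuousAt (riccatiGain A B R) P := by
    have hc : Continuous fun p : Matrix (Fin m) (Fin m) ℝ × Matrix (Fin n) (Fin n) ℝ =>
      -(p.1 * (Bᵀ * p.2 * A)) := by fun_prop
    exact ContinuousAt.comp (f := fun P => ((inputWeight B R P)⁻¹, P)) hc.continuousAt
      (h1.prodMk continuousAt_id)
  have hc : Continuous fun p : Matrix (Fin n) (Fin n) ℝ × Matrix (Fin m) (Fin n) ℝ =>
      stepCost A B Q R p.1 p.2 := by unfold stepCost; fun_prop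
  exact ContinuousAt.comp (f := fun P => (P, riccatiGain A B R P)) hc.continuousAt
      (continuousAt_id.prodMk h2)

end Algebra

/-! ### Limits of matrix sequences. -/

/-- A monotone sequence of positive semidefinite matrices with bounded quadratic forms converges. -/
theorem exists_tendsto_of_monotone {n : ℕ} (M : ℕ → Matrix (Fin n) (Fin n) ℝ)
    (hs : ∀ j, (M j)ᵀ = M j) (hm : ∀ j, (M (j + 1) - M j).PosSemidef)
    (hb : ∀ x : Fin n → ℝ, ∃ b, ∀ j, x ⬝ᵥ M j *ᵥ x ≤ b) :
    ∃ P, Tendsto M atTop (𝓝 P) := by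
  have hq : ∀ x : Fin n → ℝ, ∃ q, Tendsto (fun j => x ⬝ᵥ M j *ᵥ x) atTop (𝓝 q) := by
    intro x
    obtain ⟨b, hb⟩ := hb x
    refine ⟨_, tendsto_atTop_ciSup (monotone_nat_of_le_succ fun j => ?_) ⟨b, ?_⟩⟩
    · have := quad_nonneg (hm j) x
      rw [sub_mulVec, dotProduct_sub] at this
      linarith
    · rintro _ ⟨j, rfl⟩; exact hb j
  choose q hq using hq
  -- Polarisation recovers the entries of the limit from the limiting quadratic form.
  refine ⟨Matrix.of fun a b => (q (Pi.single a 1 + Pi.single b 1) - q (Pi.single a 1) -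
    q (Pi.single b 1)) / 2, ?_⟩
  refine tendsto_pi_nhds.2 fun a => tendsto_pi_nhds.2 fun b => ?_
  have := (((hq (Pi.single a 1 + Pi.single b 1)).sub (hq (Pi.single a 1))).sub
    (hq (Pi.single b 1))).div_const 2
  refine this.congr fun j => ?_
  have hab : M j b a = M j a b := congrFun (congrFun (hs j) a) b
  simp [mulVec_add, add_dotProduct, hab]
  ring

theorem posSemidef_of_tendsto {n : ℕ} {M : ℕ → Matrix (Fin n) (Fin n) ℝ}
    {P : Matrix (Fin n) (Fin n) ℝ} (h : Tendsto M atTop (𝓝 P)) (hM : ∀ j, (M j).PosSemidef) :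
    P.PosSemidef := by
  refine posSemidef_of_quad ?_ fun x => ?_
  · have h1 : Tendsto (fun j => (M j)ᵀ) atTop (𝓝 Pᵀ) :=
      ((by fun_prop : Continuous fun N : Matrix (Fin n) (Fin n) ℝ => Nᵀ).tendsto P).comp h
    refine tendsto_nhds_unique h1 (h.congr fun j => (transpose_eq_of_posSemidef (hM j)).symm)
  · have h1 : Tendsto (fun j => x ⬝ᵥ M j *ᵥ x) atTop (𝓝 (x ⬝ᵥ P *ᵥ x)) :=
      ((by fun_prop : Continuous fun N : Matrix (Fin n) (Fin n) ℝ => x ⬝ᵥ N *ᵥ x).tendsto P).comp h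
    exact ge_of_tendsto' h1 fun j => quad_nonneg (hM j) x

/-! ### Euclidean estimates; bounded and periodic sequences. -/

section EuclideanNorm

variable {p q : ℕ}

/-- The Euclidean norm of a vector. -/
noncomputable abbrev euclNorm (x : Fin p → ℝ) : ℝ := ‖WithLp.toLp 2 x‖

theorem euclNorm_nonneg (x : Fin p → ℝ) : 0 ≤ euclNorm x := norm_nonneg _

theorem euclNorm_add_le (x y : Fin p → ℝ) : euclNorm (x + y) ≤ euclNorm x + euclNorm y := by
  simpa [euclNorm] using norm_add_le (WithLp.toLp 2 x) (WithLp.toLp 2 y)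

theorem euclNorm_sub_le (x y : Fin p → ℝ) : euclNorm (x - y) ≤ euclNorm x + euclNorm y := by
  simpa [euclNorm] using norm_sub_le (WithLp.toLp 2 x) (WithLp.toLp 2 y)

theorem dotProduct_self_eq_sq (x : Fin p → ℝ) : x ⬝ᵥ x = euclNorm x ^ 2 := by
  rw [euclNorm, EuclideanSpace.norm_sq_eq]
  simp [dotProduct, sq]

theorem dotProduct_le (x y : Fin p → ℝ) : x ⬝ᵥ y ≤ euclNorm x * euclNorm y := by
  have := real_inner_le_norm (WithLp.toLp 2 y) (WithLp.toLp 2 x)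
  rw [EuclideanSpace.inner_eq_star_dotProduct] at this
  rw [mul_comm]
  simpa using this

theorem abs_apply_le_euclNorm (x : Fin p → ℝ) (i : Fin p) : |x i| ≤ euclNorm x := by
  simpa using PiLp.norm_apply_le (WithLp.toLp 2 x) i

theorem euclNorm_le_sum (x : Fin p → ℝ) : euclNorm x ≤ ∑ i, |x i| := by
  refine abs_le_of_sq_le_sq' ?_ (Finset.sum_nonneg fun _ _ => abs_nonneg _) |>.2
  rw [← dotProduct_self_eq_sq]
  have : x ⬝ᵥ x = ∑ i, |x i| ^ 2 := by simp [dotProduct, sq]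
  rw [this]
  exact Finset.sum_sq_le_sq_sum_of_nonneg fun _ _ => abs_nonneg _

theorem BoundedSeq.exists_mulVec_le {M : ℕ → Matrix (Fin p) (Fin q) ℝ} (h : BoundedSeq M) :
    ∃ b, 0 ≤ b ∧ ∀ k x, euclNorm (M k *ᵥ x) ≤ b * euclNorm x := by
  obtain ⟨b, hb⟩ := h
  refine ⟨p * (q * |b|), by positivity, fun k x => ?_⟩
  have hi : ∀ i, |(M k *ᵥ x) i| ≤ q * |b| * euclNorm x := by
    intro i
    calc |(M k *ᵥ x) i| ≤ ∑ j, |M k i j * x j| := by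
          simpa [mulVec, dotProduct] using
            Finset.abs_sum_le_sum_abs (fun j => M k i j * x j) Finset.univ
      _ ≤ ∑ _j : Fin q, |b| * euclNorm x := by
          refine Finset.sum_le_sum fun j _ => ?_
          rw [abs_mul]
          exact mul_le_mul ((hb k i j).trans (le_abs_self b)) (abs_apply_le_euclNorm x j)
            (abs_nonneg _) (abs_nonneg _)
      _ = _ := by simp [mul_assoc]
  calc _ ≤ ∑ i, |(M k *ᵥ x) i| := euclNorm_le_sum _
    _ ≤ ∑ _i : Fin p, q * |b| * euclNorm x := Finset.sum_le_sum fun i _ => hi i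
    _ = _ := by simp [mul_assoc]

theorem BoundedSeq.exists_quad_le {M : ℕ → Matrix (Fin p) (Fin p) ℝ} (h : BoundedSeq M) :
    ∃ b, 0 ≤ b ∧ ∀ k x, x ⬝ᵥ M k *ᵥ x ≤ b * euclNorm x ^ 2 := by
  obtain ⟨b, hb0, hb⟩ := h.exists_mulVec_le
  refine ⟨b, hb0, fun k x => (dotProduct_le _ _).trans ?_⟩
  calc _ ≤ euclNorm x * (b * euclNorm x) :=
        mul_le_mul_of_nonneg_left (hb k x) (euclNorm_nonneg x)
    _ = _ := by ring

theorem PeriodicSeq.add_mul {α : Type*} {φ : ℕ} {M : ℕ → α} (h : PeriodicSeq φ M) (k j : ℕ) :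
    M (k + j * φ) = M k := by
  induction j with
  | zero => simp
  | succ j ih => rw [Nat.succ_mul, ← Nat.add_assoc, h, ih]

theorem PeriodicSeq.mod {α : Type*} {φ : ℕ} {M : ℕ → α} (h : PeriodicSeq φ M) (k : ℕ) :
    M k = M (k % φ) := by
  conv_lhs => rw [← Nat.mod_add_div k φ, mul_comm φ]
  exact h.add_mul _ _

theorem PeriodicSeq.exists_le {φ : ℕ} (hφ : 0 < φ) {f : ℕ → ℝ} (h : PeriodicSeq φ f) :
    ∃ b, ∀ k, f k ≤ b := by
  obtain ⟨b, hb⟩ := ((Finset.range φ).image f).exists_le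
  refine ⟨b, fun k => ?_⟩
  rw [h.mod k]
  exact hb _ (Finset.mem_image_of_mem f (Finset.mem_range.2 (Nat.mod_lt k hφ)))

theorem PeriodicSeq.bounded {φ : ℕ} (hφ : 0 < φ) {M : ℕ → Matrix (Fin p) (Fin q) ℝ}
    (h : PeriodicSeq φ M) : BoundedSeq M := by
  obtain ⟨b, hb⟩ := PeriodicSeq.exists_le hφ (f := fun k => ∑ i, ∑ j, |M k i j|)
    fun k => by simp only [h k]
  refine ⟨b, fun k i j => le_trans ?_ (hb k)⟩
  refine le_trans ?_ (Finset.single_le_sum (f := fun i => ∑ j, |M k i j|)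
    (fun i _ => Finset.sum_nonneg fun _ _ => abs_nonneg _) (Finset.mem_univ i))
  exact Finset.single_le_sum (f := fun j => |M k i j|) (fun _ _ => abs_nonneg _)
    (Finset.mem_univ j)

end EuclideanNorm

/-! ### Value iteration, the periodic Riccati equation, optimality and uniqueness. -/

section Cost

variable {n m : ℕ} (A : ℕ → Matrix (Fin n) (Fin n) ℝ) (B : ℕ → Matrix (Fin n) (Fin m) ℝ)
  (Q : ℕ → Matrix (Fin n) (Fin n) ℝ) (R : ℕ → Matrix (Fin m) (Fin m) ℝ)

theorem state_succ' (k : ℕ) (x : Fin n → ℝ) (u : ℕ → Fin m → ℝ) (i : ℕ) :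
    state A B k x u (i + 1) =
      state A B (k + 1) (A k *ᵥ x + B k *ᵥ u 0) (fun j => u (j + 1)) i := by
  induction i with
  | zero => simp [state]
  | succ i ih => rw [state, ih, state]; simp [Nat.add_assoc, Nat.add_comm 1]

theorem state_feedbackInput (K : ℕ → Matrix (Fin m) (Fin n) ℝ) (k : ℕ) (x : Fin n → ℝ) (i : ℕ) :
    state A B k x (feedbackInput A B K k x) i = freeState (closedLoop A B K) k x i := by
  induction i with
  | zero => rfl
  | succ i ih =>
    rw [state, ih, freeState]
    simp [feedbackInput, closedLoop, add_mulVec, mulVec_mulVec]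

/-- The cost of the first `N` steps. -/
def finiteCost (N k : ℕ) (x : Fin n → ℝ) (u : ℕ → Fin m → ℝ) : ℝ :=
  ∑ i ∈ Finset.range N, (state A B k x u i ⬝ᵥ Q (k + i) *ᵥ state A B k x u i +
    u i ⬝ᵥ R (k + i) *ᵥ u i)

/-- Value iteration: the value matrices of the problem with horizon `N`. -/
noncomputable def valueIter : ℕ → ℕ → Matrix (Fin n) (Fin n) ℝ
  | 0, _ => 0
  | N + 1, k => riccati (A k) (B k) (Q k) (R k) (valueIter N (k + 1))

variable {A B Q R}

theorem stage_nonneg (hQ : ∀ k, (Q k).PosSemidef) (hR : ∀ k, (R k).PosDef) (k : ℕ)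
    (x : Fin n → ℝ) (u : Fin m → ℝ) : 0 ≤ x ⬝ᵥ Q k *ᵥ x + u ⬝ᵥ R k *ᵥ u :=
  add_nonneg (quad_nonneg (hQ k) x) (quad_nonneg (hR k).posSemidef u)

theorem ofReal_finiteCost_le (hQ : ∀ k, (Q k).PosSemidef) (hR : ∀ k, (R k).PosDef) (N k : ℕ)
    (x : Fin n → ℝ) (u : ℕ → Fin m → ℝ) :
    ENNReal.ofReal (finiteCost A B Q R N k x u) ≤ cost A B Q R k x u := by
  rw [finiteCost, ENNReal.ofReal_sum_of_nonneg fun i _ => stage_nonneg hQ hR _ _ _]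
  exact ENNReal.sum_le_tsum _

theorem cost_le_ofReal (hQ : ∀ k, (Q k).PosSemidef) (hR : ∀ k, (R k).PosDef) {k : ℕ}
    {x : Fin n → ℝ} {u : ℕ → Fin m → ℝ} {b : ℝ} (h : ∀ N, finiteCost A B Q R N k x u ≤ b) :
    cost A B Q R k x u ≤ ENNReal.ofReal b := by
  rw [cost, ENNReal.tsum_eq_iSup_nat]
  refine iSup_le fun N => ?_
  rw [← ENNReal.ofReal_sum_of_nonneg fun i _ => stage_nonneg hQ hR _ _ _]
  exact ENNReal.ofReal_le_ofReal (h N)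

theorem valueIter_posSemidef (hQ : ∀ k, (Q k).PosSemidef) (hR : ∀ k, (R k).PosDef) (N k : ℕ) :
    (valueIter A B Q R N k).PosSemidef := by
  induction N generalizing k with
  | zero => exact .zero
  | succ N ih => exact stepCost_posSemidef _ _ (hQ k) (hR k) (ih _) _

/-- The first iterate dominates the zero start, and `riccati_mono` propagates the order. -/
theorem valueIter_mono (hQ : ∀ k, (Q k).PosSemidef) (hR : ∀ k, (R k).PosDef) (N k : ℕ) :
    (valueIter A B Q R (N + 1) k - valueIter A B Q R N k).PosSemidef := by
  induction N generalizing k with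
  | zero => simpa [valueIter] using valueIter_posSemidef (A := A) (B := B) hQ hR 1 k
  | succ N ih => exact riccati_mono _ _ (hR k) (valueIter_posSemidef hQ hR _ _) (ih _)

theorem valueIter_periodic {φ : ℕ} (hA : PeriodicSeq φ A) (hB : PeriodicSeq φ B)
    (hQ : PeriodicSeq φ Q) (hR : PeriodicSeq φ R) (N : ℕ) :
    PeriodicSeq φ (valueIter A B Q R N) := by
  induction N with
  | zero => exact fun _ => rfl
  | succ N ih =>
    intro k
    rw [valueIter, valueIter, hA, hB, hQ, hR, Nat.add_right_comm, ih]

/-- Bellman's principle: split off the first stage, apply induction to the tail, and drop the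
nonnegative square. -/
theorem valueIter_le_finiteCost (hQ : ∀ k, (Q k).PosSemidef) (hR : ∀ k, (R k).PosDef) (N k : ℕ)
    (x : Fin n → ℝ) (u : ℕ → Fin m → ℝ) :
    x ⬝ᵥ valueIter A B Q R N k *ᵥ x ≤ finiteCost A B Q R N k x u := by
  induction N generalizing k x u with
  | zero => simp [valueIter, finiteCost]
  | succ N ih =>
    have h1 := ih (k + 1) (A k *ᵥ x + B k *ᵥ u 0) (fun j => u (j + 1))
    have hV := valueIter_posSemidef (A := A) (B := B) hQ hR N (k + 1)
    have h2 := completion_of_squares_vec (A k) (B k) (Q := Q k) (hR k) hV x (u 0)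
    have h3 := quad_nonneg (inputWeight_posDef (B k) (hR k) hV).posSemidef
      (u 0 - riccatiGain (A k) (B k) (R k) (valueIter A B Q R N (k + 1)) *ᵥ x)
    have h4 : finiteCost A B Q R (N + 1) k x u = finiteCost A B Q R N (k + 1)
        (A k *ᵥ x + B k *ᵥ u 0) (fun j => u (j + 1)) + (x ⬝ᵥ Q k *ᵥ x + u 0 ⬝ᵥ R k *ᵥ u 0) := by
      rw [finiteCost, Finset.sum_range_succ', finiteCost]
      simp only [state_succ', Nat.add_assoc, Nat.add_comm 1, Nat.add_zero]
      rfl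
    rw [valueIter, h4]
    linarith

/-- Under a bounded stabilising feedback the stage costs decay like r^(2i), so a geometric series
bounds all horizons at once. -/
theorem exists_finiteCost_le (hQ : BoundedSeq Q) (hR : BoundedSeq R) (hs : Stabilisable A B)
    (k : ℕ) (x : Fin n → ℝ) : ∃ u b, ∀ N, finiteCost A B Q R N k x u ≤ b := by
  obtain ⟨K, hK, c, r, hc, hr0, hr1, hst⟩ := hs
  obtain ⟨a, ha0, ha⟩ := hQ.exists_quad_le
  obtain ⟨d, hd0, hd⟩ := hR.exists_quad_le
  obtain ⟨e, he0, he⟩ := hK.exists_mulVec_le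
  refine ⟨feedbackInput A B K k x,
    (a + d * e ^ 2) * (c * euclNorm x) ^ 2 * (1 - r ^ 2)⁻¹, fun N => ?_⟩
  have hr2 : r ^ 2 < 1 := by nlinarith
  calc _ ≤ ∑ i ∈ Finset.range N, (a + d * e ^ 2) * (c * euclNorm x) ^ 2 * (r ^ 2) ^ i := by
        refine Finset.sum_le_sum fun i _ => ?_
        rw [state_feedbackInput, feedbackInput]
        set y := freeState (closedLoop A B K) k x i
        have h1 := ha (k + i) y
        have h2 := hd (k + i) (K (k + i) *ᵥ y)
        have h3 : euclNorm (K (k + i) *ᵥ y) ^ 2 ≤ (e * euclNorm y) ^ 2 :=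
          pow_le_pow_left₀ (euclNorm_nonneg _) (he _ _) 2
        have h4 : euclNorm y ^ 2 ≤ (c * r ^ i * euclNorm x) ^ 2 :=
          pow_le_pow_left₀ (euclNorm_nonneg _) (hst k x i) 2
        calc _ ≤ a * euclNorm y ^ 2 + d * (e * euclNorm y) ^ 2 :=
              add_le_add h1 (h2.trans (mul_le_mul_of_nonneg_left h3 hd0))
          _ = (a + d * e ^ 2) * euclNorm y ^ 2 := by ring
          _ ≤ (a + d * e ^ 2) * (c * r ^ i * euclNorm x) ^ 2 :=
              mul_le_mul_of_nonneg_left h4 (by positivity)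
          _ = _ := by rw [← pow_mul, mul_comm 2 i, pow_mul]; ring
    _ ≤ _ := by
        rw [← Finset.mul_sum]
        refine mul_le_mul_of_nonneg_left ?_ (by positivity)
        rw [← tsum_geometric_of_lt_one (sq_nonneg r) hr2]
        exact (summable_geometric_of_lt_one (sq_nonneg r) hr2).sum_le_tsum _
          fun i _ => by positivity

/-- The periodic Riccati equation has a periodic positive semidefinite solution, which is a lower
bound for the cost. -/
theorem exists_riccati_solution {φ : ℕ} (hφ : 0 < φ) (hA : PeriodicSeq φ A) (hB : PeriodicSeq φ B)
    (hQ : PeriodicSeq φ Q) (hR : PeriodicSeq φ R) (hQpos : ∀ k, (Q k).PosSemidef)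
    (hRpos : ∀ k, (R k).PosDef) (hs : Stabilisable A B) :
    ∃ P : ℕ → Matrix (Fin n) (Fin n) ℝ, PeriodicSeq φ P ∧ (∀ k, (P k).PosSemidef) ∧
      (∀ k, P k = riccati (A k) (B k) (Q k) (R k) (P (k + 1))) ∧
      ∀ k x u, ENNReal.ofReal (x ⬝ᵥ P k *ᵥ x) ≤ cost A B Q R k x u := by
  have hV := valueIter_posSemidef (A := A) (B := B) hQpos hRpos
  have hex : ∀ k, ∃ P, Tendsto (fun N => valueIter A B Q R N k) atTop (𝓝 P) := by
    intro k
    refine exists_tendsto_of_monotone _ (fun N => transpose_eq_of_posSemidef (hV N k))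
      (fun N => valueIter_mono hQpos hRpos N k) fun x => ?_
    obtain ⟨u, b, hb⟩ := exists_finiteCost_le (PeriodicSeq.bounded hφ hQ)
      (PeriodicSeq.bounded hφ hR) hs k x
    exact ⟨b, fun N => (valueIter_le_finiteCost hQpos hRpos N k x u).trans (hb N)⟩
  choose P hP using hex
  have hPpos : ∀ k, (P k).PosSemidef := fun k => posSemidef_of_tendsto (hP k) fun N => hV N k
  refine ⟨P, fun k => ?_, hPpos, fun k => ?_, fun k x u => ?_⟩
  · refine tendsto_nhds_unique (hP (k + φ)) ((hP k).congr fun N => ?_)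
    rw [valueIter_periodic hA hB hQ hR N k]
  · exact tendsto_nhds_unique ((hP k).comp (tendsto_add_atTop_nat 1))
      ((continuousAt_riccati (A k) (B k) (Q := Q k) (hRpos k) (hPpos (k + 1))).tendsto.comp
        (hP (k + 1)))
  · have h1 : Tendsto (fun N => x ⬝ᵥ valueIter A B Q R N k *ᵥ x) atTop (𝓝 (x ⬝ᵥ P k *ᵥ x)) :=
      ((by fun_prop : Continuous fun N : Matrix (Fin n) (Fin n) ℝ => x ⬝ᵥ N *ᵥ x).tendsto
        (P k)).comp (hP k)
    refine le_of_tendsto' ((ENNReal.continuous_ofReal.tendsto _).comp h1) fun N => ?_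
    exact (ENNReal.ofReal_le_ofReal (valueIter_le_finiteCost hQpos hRpos N k x u)).trans
      (ofReal_finiteCost_le hQpos hRpos N k x u)

/-- The gain sequence belonging to a solution of the Riccati equation. -/
noncomputable def riccatiGainSeq (A : ℕ → Matrix (Fin n) (Fin n) ℝ)
    (B : ℕ → Matrix (Fin n) (Fin m) ℝ) (R : ℕ → Matrix (Fin m) (Fin m) ℝ)
    (P : ℕ → Matrix (Fin n) (Fin n) ℝ) (k : ℕ) : Matrix (Fin m) (Fin n) ℝ :=
  riccatiGain (A k) (B k) (R k) (P (k + 1))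

variable {P : ℕ → Matrix (Fin n) (Fin n) ℝ}

/-- Completion of squares at each stage, telescoped by the Riccati equation. It is an exact
identity, so it yields both the cost of the Riccati gain and the penalty for any deviation. -/
theorem finiteCost_add_eq (hR : ∀ k, (R k).PosDef) (hP : ∀ k, (P k).PosSemidef)
    (hric : ∀ k, P k = riccati (A k) (B k) (Q k) (R k) (P (k + 1))) (N k : ℕ) (x : Fin n → ℝ)
    (u : ℕ → Fin m → ℝ) :
    finiteCost A B Q R N k x u + state A B k x u N ⬝ᵥ P (k + N) *ᵥ state A B k x u N =
      x ⬝ᵥ P k *ᵥ x + ∑ i ∈ Finset.range N,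
        (u i - riccatiGainSeq A B R P (k + i) *ᵥ state A B k x u i) ⬝ᵥ
          inputWeight (B (k + i)) (R (k + i)) (P (k + i + 1)) *ᵥ
          (u i - riccatiGainSeq A B R P (k + i) *ᵥ state A B k x u i) := by
  induction N with
  | zero => simp [finiteCost, state]
  | succ N ih =>
    have h := completion_of_squares_vec (A (k + N)) (B (k + N)) (Q := Q (k + N)) (hR (k + N))
      (hP (k + N + 1)) (state A B k x u N) (u N)
    rw [← hric] at h
    rw [Finset.sum_range_succ, ← add_assoc (x ⬝ᵥ P k *ᵥ x), ← ih, finiteCost,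
      Finset.sum_range_succ, ← finiteCost, state, ← Nat.add_assoc, riccatiGainSeq]
    linarith

theorem cost_riccatiGainSeq_le (hQ : ∀ k, (Q k).PosSemidef) (hR : ∀ k, (R k).PosDef)
    (hP : ∀ k, (P k).PosSemidef)
    (hric : ∀ k, P k = riccati (A k) (B k) (Q k) (R k) (P (k + 1))) (k : ℕ) (x : Fin n → ℝ) :
    cost A B Q R k x (feedbackInput A B (riccatiGainSeq A B R P) k x) ≤
      ENNReal.ofReal (x ⬝ᵥ P k *ᵥ x) := by
  refine cost_le_ofReal hQ hR fun N => ?_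
  have h1 := finiteCost_add_eq hR hP hric N k x
    (feedbackInput A B (riccatiGainSeq A B R P) k x)
  have h2 : ∀ i, feedbackInput A B (riccatiGainSeq A B R P) k x i -
      riccatiGainSeq A B R P (k + i) *ᵥ
        state A B k x (feedbackInput A B (riccatiGainSeq A B R P) k x) i = 0 := fun i => by
    rw [state_feedbackInput, feedbackInput, sub_self]
  simp only [h2, mulVec_zero, dotProduct_zero, Finset.sum_const_zero, add_zero] at h1
  have h3 := quad_nonneg (hP (k + N))
    (state A B k x (feedbackInput A B (riccatiGainSeq A B R P) k x) N)
  linarith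

theorem isOptimalGain_riccatiGainSeq (hQ : ∀ k, (Q k).PosSemidef) (hR : ∀ k, (R k).PosDef)
    (hP : ∀ k, (P k).PosSemidef)
    (hric : ∀ k, P k = riccati (A k) (B k) (Q k) (R k) (P (k + 1)))
    (hlow : ∀ k x u, ENNReal.ofReal (x ⬝ᵥ P k *ᵥ x) ≤ cost A B Q R k x u)
    (hst : ExpStable (closedLoop A B (riccatiGainSeq A B R P))) :
    IsOptimalGain A B Q R (riccatiGainSeq A B R P) := by
  refine ⟨hst, fun k x => ?_⟩
  have h := cost_riccatiGainSeq_le hQ hR hP hric k x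
  exact ⟨h.trans_lt ENNReal.ofReal_lt_top, fun u => h.trans (hlow k x u)⟩

/-- Optimality bounds the cost of K by the value xᵀ P x, so the accumulated penalty is at most the
terminal term. Stability of K sends that term to zero, so already the first penalty vanishes, for
every initial state. -/
theorem IsOptimalGain.eq_riccatiGainSeq {K : ℕ → Matrix (Fin m) (Fin n) ℝ}
    (hK : IsOptimalGain A B Q R K) (hQ : ∀ k, (Q k).PosSemidef) (hR : ∀ k, (R k).PosDef)
    (hPb : BoundedSeq P) (hP : ∀ k, (P k).PosSemidef)
    (hric : ∀ k, P k = riccati (A k) (B k) (Q k) (R k) (P (k + 1))) :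
    K = riccatiGainSeq A B R P := by
  funext k
  suffices h : ∀ x, K k *ᵥ x - riccatiGainSeq A B R P k *ᵥ x = 0 from
    Matrix.ext_of_mulVec_single fun i => sub_eq_zero.1 (h _)
  intro x
  obtain ⟨p, hp0, hp⟩ := hPb.exists_quad_le
  obtain ⟨c, r, hc, hr0, hr1, hst⟩ := hK.1
  have hpos : ∀ i (z : Fin m → ℝ),
      0 ≤ z ⬝ᵥ inputWeight (B (k + i)) (R (k + i)) (P (k + i + 1)) *ᵥ z := fun i z =>
    quad_nonneg (inputWeight_posDef _ (hR _) (hP _)).posSemidef z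
  set u := feedbackInput A B K k x with hu
  have hfin : ∀ N, finiteCost A B Q R N k x u ≤ x ⬝ᵥ P k *ᵥ x := fun N =>
    (ENNReal.ofReal_le_ofReal_iff (quad_nonneg (hP k) x)).1
      ((ofReal_finiteCost_le hQ hR N k x u).trans
        (((hK.2 k x).2 _).trans (cost_riccatiGainSeq_le hQ hR hP hric k x)))
  set z := K k *ᵥ x - riccatiGainSeq A B R P k *ᵥ x with hz
  -- Horizon N + 1, so that the sum contains the penalty at index 0.
  have hle : ∀ N, z ⬝ᵥ inputWeight (B k) (R k) (P (k + 1)) *ᵥ z ≤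
      p * (c * r ^ (N + 1) * euclNorm x) ^ 2 := by
    intro N
    have h1 := finiteCost_add_eq hR hP hric (N + 1) k x u
    have h2 := Finset.single_le_sum (f := fun i =>
      (u i - riccatiGainSeq A B R P (k + i) *ᵥ state A B k x u i) ⬝ᵥ
          inputWeight (B (k + i)) (R (k + i)) (P (k + i + 1)) *ᵥ
          (u i - riccatiGainSeq A B R P (k + i) *ᵥ state A B k x u i))
      (fun i _ => hpos i _) (Finset.mem_range.2 (Nat.succ_pos N))
    have h3 := hp (k + (N + 1)) (state A B k x u (N + 1))
    have h4 : euclNorm (state A B k x u (N + 1)) ^ 2 ≤ (c * r ^ (N + 1) * euclNorm x) ^ 2 := by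
      refine pow_le_pow_left₀ (euclNorm_nonneg _) ?_ 2
      rw [hu, state_feedbackInput]
      exact hst k x (N + 1)
    have h5 := mul_le_mul_of_nonneg_left h4 hp0
    have h6 : z = u 0 - riccatiGainSeq A B R P (k + 0) *ᵥ state A B k x u 0 := rfl
    have h7 := hfin (N + 1)
    rw [h6]
    simp only [Nat.add_zero, Nat.succ_eq_add_one] at h2 ⊢
    linarith
  have hlim : Tendsto (fun N : ℕ => p * (c * r ^ (N + 1) * euclNorm x) ^ 2) atTop (𝓝 0) := by
    have h := (tendsto_pow_atTop_nhds_zero_of_lt_one hr0.le hr1).comp (tendsto_add_atTop_nat 1)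
    simpa using (((h.const_mul c).mul_const (euclNorm x)).pow 2).const_mul p
  by_contra hne
  have h1 : 0 < z ⬝ᵥ inputWeight (B k) (R k) (P (k + 1)) *ᵥ z := by
    simpa using (inputWeight_posDef (B k) (hR k) (hP (k + 1))).dotProduct_mulVec_pos hne
  exact absurd (ge_of_tendsto' hlim hle) (not_le.2 h1)

end Cost

/-! ### Lyapunov functions and stability from detectability. -/

section Stability

variable {n m : ℕ}

theorem freeState_succ' (F : ℕ → Matrix (Fin n) (Fin n) ℝ) (k : ℕ) (x : Fin n → ℝ) (i : ℕ) :
    freeState F k x (i + 1) = freeState F (k + 1) (F k *ᵥ x) i := by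
  induction i with
  | zero => simp [freeState]
  | succ i ih => rw [freeState, ih, freeState, Nat.add_assoc, Nat.add_comm 1]

theorem freeState_add (F : ℕ → Matrix (Fin n) (Fin n) ℝ) (k : ℕ) (x y : Fin n → ℝ) (i : ℕ) :
    freeState F k (x + y) i = freeState F k x i + freeState F k y i := by
  induction i with
  | zero => rfl
  | succ i ih => rw [freeState, ih, mulVec_add]; rfl

/-- A uniformly exponentially stable system contracts a family of norms which is uniformly
equivalent to the Euclidean norm. -/
theorem ExpStable.exists_norm {F : ℕ → Matrix (Fin n) (Fin n) ℝ} (h : ExpStable F) :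
    ∃ (ν : ℕ → (Fin n → ℝ) → ℝ) (c r : ℝ), 0 < c ∧ 0 < r ∧ r < 1 ∧
      (∀ k x, euclNorm x ≤ ν k x) ∧ (∀ k x, ν k x ≤ c * euclNorm x) ∧
      (∀ k x y, ν k (x + y) ≤ ν k x + ν k y) ∧ ∀ k x, ν (k + 1) (F k *ᵥ x) ≤ r * ν k x := by
  obtain ⟨c, r, hc, hr0, hr1, hst⟩ := h
  have hle : ∀ k x i, euclNorm (freeState F k x i) / r ^ i ≤ c * euclNorm x := by
    intro k x i
    rw [div_le_iff₀ (pow_pos hr0 i)]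
    refine (hst k x i).trans (le_of_eq ?_)
    ring
  have hbdd : ∀ k x, BddAbove (Set.range fun i => euclNorm (freeState F k x i) / r ^ i) :=
    fun k x => ⟨c * euclNorm x, by rintro _ ⟨i, rfl⟩; exact hle k x i⟩
  -- The norm is the supremum of the trajectory rescaled by r^(-i). One step of the system drops the
  -- term i = 0 and leaves a factor r.
  refine ⟨fun k x => ⨆ i, euclNorm (freeState F k x i) / r ^ i, c, r, hc, hr0, hr1,
    fun k x => ?_, fun k x => ciSup_le (hle k x), fun k x y => ciSup_le fun i => ?_,
    fun k x => ciSup_le fun i => ?_⟩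
  · simpa [freeState] using le_ciSup (hbdd k x) 0
  · refine le_trans ?_ (add_le_add (le_ciSup (hbdd k x) i) (le_ciSup (hbdd k y) i))
    rw [freeState_add, ← add_div]
    exact div_le_div_of_nonneg_right (euclNorm_add_le _ _) (pow_pos hr0 i).le
  · rw [← freeState_succ']
    have h1 := mul_le_mul_of_nonneg_left (le_ciSup (hbdd k x) (i + 1)) hr0.le
    refine le_trans (le_of_eq ?_) h1
    rw [pow_succ]
    field_simp

/-- Exponential stability from a quadratically bounded Lyapunov function. -/
theorem expStable_of_lyapunov {F : ℕ → Matrix (Fin n) (Fin n) ℝ} (Z : ℕ → (Fin n → ℝ) → ℝ)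
    {c q : ℝ} (hc : 0 < c) (hq0 : 0 < q) (hq1 : q < 1)
    (hlow : ∀ k x, euclNorm x ^ 2 ≤ Z k x) (hup : ∀ k x, Z k x ≤ c * euclNorm x ^ 2)
    (hdec : ∀ k x, Z (k + 1) (F k *ᵥ x) ≤ q * Z k x) : ExpStable F := by
  refine ⟨√c, √q, Real.sqrt_pos.2 hc, Real.sqrt_pos.2 hq0, ?_, fun k x i => ?_⟩
  · rw [Real.sqrt_lt' one_pos]; simpa using hq1
  · have hZ : ∀ i, Z (k + i) (freeState F k x i) ≤ q ^ i * Z k x := by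
      intro i
      induction i with
      | zero => simp [freeState]
      | succ i ih =>
        rw [freeState, ← Nat.add_assoc]
        refine (hdec _ _).trans ((mul_le_mul_of_nonneg_left ih hq0.le).trans (le_of_eq ?_))
        ring
    refine abs_le_of_sq_le_sq' ?_ (by positivity) |>.2
    calc _ ≤ Z (k + i) (freeState F k x i) := hlow _ _
      _ ≤ q ^ i * Z k x := hZ i
      _ ≤ q ^ i * (c * euclNorm x ^ 2) := mul_le_mul_of_nonneg_left (hup k x) (by positivity)
      _ = (√c * √q ^ i * ‖WithLp.toLp 2 x‖) ^ 2 := by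
        rw [mul_pow, mul_pow, ← pow_mul, mul_comm i 2, pow_mul, Real.sq_sqrt hc.le,
          Real.sq_sqrt hq0.le]
        ring

variable {A : ℕ → Matrix (Fin n) (Fin n) ℝ} {B : ℕ → Matrix (Fin n) (Fin m) ℝ}
  {Q : ℕ → Matrix (Fin n) (Fin n) ℝ} {R : ℕ → Matrix (Fin m) (Fin m) ℝ}
  {P : ℕ → Matrix (Fin n) (Fin n) ℝ}

theorem euclNorm_sqrtMat_sq {M : Matrix (Fin n) (Fin n) ℝ} (h : M.PosSemidef) (x : Fin n → ℝ) :
    euclNorm (sqrtMat M *ᵥ x) ^ 2 = x ⬝ᵥ M *ᵥ x := by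
  have h' := quad_transpose_mul_mul 1 (sqrtMat M) x
  rw [sqrtMat_transpose, Matrix.mul_one, sqrtMat_mul_self h, one_mulVec,
    dotProduct_self_eq_sq] at h'
  exact h'.symm

/-- Write x = (M⁻¹ M^{1/2})(M^{1/2} x), where M^{1/2} x has squared norm xᵀ M x. -/
theorem exists_sq_le_quad_of_posDef {M : Matrix (Fin m) (Fin m) ℝ} (h : M.PosDef) :
    ∃ b, 0 ≤ b ∧ ∀ x, euclNorm x ^ 2 ≤ b * (x ⬝ᵥ M *ᵥ x) := by
  have hu := (isUnit_iff_isUnit_det _).1 h.isUnit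
  have hM := sqrtMat_mul_self h.posSemidef
  have hbdd : BoundedSeq fun _ : ℕ => M⁻¹ * sqrtMat M :=
    PeriodicSeq.bounded one_pos fun _ => rfl
  obtain ⟨b, hb0, hb⟩ := hbdd.exists_mulVec_le
  refine ⟨b ^ 2, by positivity, fun x => ?_⟩
  have h1 := hb 0 (sqrtMat M *ᵥ x)
  rw [mulVec_mulVec, Matrix.mul_assoc, hM, nonsing_inv_mul _ hu, one_mulVec] at h1
  calc _ ≤ (b * euclNorm (sqrtMat M *ᵥ x)) ^ 2 := pow_le_pow_left₀ (euclNorm_nonneg _) h1 2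
    _ = _ := by rw [mul_pow, euclNorm_sqrtMat_sq h.posSemidef]

theorem PeriodicSeq.exists_sq_le_quad {φ : ℕ} (hφ : 0 < φ) (hper : PeriodicSeq φ R)
    (hR : ∀ k, (R k).PosDef) :
    ∃ b, 0 ≤ b ∧ ∀ k x, euclNorm x ^ 2 ≤ b * (x ⬝ᵥ R k *ᵥ x) := by
  choose b hb0 hb using fun k => exists_sq_le_quad_of_posDef (hR k)
  -- The chosen constants need not be periodic in k; reducing the index modulo the period makes them
  -- so.
  obtain ⟨d, hd⟩ := PeriodicSeq.exists_le hφ (f := fun k => b (k % φ)) fun k => by simp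
  refine ⟨d, (hb0 _).trans (hd 0), fun k x => ?_⟩
  rw [hper.mod k]
  exact (hb _ x).trans (mul_le_mul_of_nonneg_right (hd k) (quad_nonneg (hR _).posSemidef x))

/-- Under detectability, a gain is stabilising if its cost is bounded by a solution of the
associated Lyapunov equation. -/
theorem expStable_closedLoop {K : ℕ → Matrix (Fin m) (Fin n) ℝ}
    (hQ : ∀ k, (Q k).PosSemidef) (hR : ∀ k, (R k).PosDef) (hB : BoundedSeq B)
    (hRlow : ∃ b, 0 ≤ b ∧ ∀ k x, euclNorm x ^ 2 ≤ b * (x ⬝ᵥ R k *ᵥ x))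
    (hdet : Detectable A fun k => sqrtMat (Q k)) (hPb : BoundedSeq P)
    (hP : ∀ k, (P k).PosSemidef)
    (hlyap : ∀ k, P k = stepCost (A k) (B k) (Q k) (R k) (P (k + 1)) (K k)) :
    ExpStable (closedLoop A B K) := by
  obtain ⟨L, hL, hLst⟩ := hdet
  obtain ⟨ν, c, r, hc, hr0, hr1, hν1, hν2, hν3, hν4⟩ := hLst.exists_norm
  obtain ⟨a, ha0, ha⟩ := hRlow
  obtain ⟨b, hb0, hb⟩ := hB.exists_mulVec_le
  obtain ⟨l, hl0, hl⟩ := hL.exists_mulVec_le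
  obtain ⟨p, hp0, hp⟩ := hPb.exists_quad_le
  have hν0 : ∀ k x, 0 ≤ ν k x := fun k x => (euclNorm_nonneg x).trans (hν1 k x)
  have hr1' : 0 < 1 - r := by linarith
  have hlyap' : ∀ k x, x ⬝ᵥ P k *ᵥ x = x ⬝ᵥ Q k *ᵥ x + (K k *ᵥ x) ⬝ᵥ R k *ᵥ (K k *ᵥ x) +
      (closedLoop A B K k *ᵥ x) ⬝ᵥ P (k + 1) *ᵥ (closedLoop A B K k *ᵥ x) := by
    intro k x
    conv_lhs => rw [hlyap k, stepCost, add_mulVec, add_mulVec, dotProduct_add, dotProduct_add,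
      quad_transpose_mul_mul, quad_transpose_mul_mul]
    rfl
  -- γ bounds the squared perturbation w below by the stage cost; β carries this through the
  -- convexity estimate for ν².
  set γ := 2 * (b ^ 2 * a + l ^ 2) with hγ
  set β := c ^ 2 * γ / (1 - r) with hβ
  have hγ0 : 0 ≤ γ := by positivity
  have hβ0 : 0 ≤ β := by positivity
  have hstep : ∀ k x, ν (k + 1) (closedLoop A B K k *ᵥ x) ^ 2 ≤ r * ν k x ^ 2 +
      β * (x ⬝ᵥ Q k *ᵥ x + (K k *ᵥ x) ⬝ᵥ R k *ᵥ (K k *ᵥ x)) := by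
    intro k x
    -- Output injection: the closed loop is the stable detector system perturbed by w, which
    -- involves only K x and Q^{1/2} x, both controlled by the stage cost.
    set w := B k *ᵥ (K k *ᵥ x) - L k *ᵥ (sqrtMat (Q k) *ᵥ x) with hw
    have hx : closedLoop A B K k *ᵥ x = (A k + L k * sqrtMat (Q k)) *ᵥ x + w := by
      rw [hw, closedLoop, add_mulVec, add_mulVec, mulVec_mulVec, mulVec_mulVec]
      abel
    have hw2 : euclNorm w ^ 2 ≤ γ * (x ⬝ᵥ Q k *ᵥ x + (K k *ᵥ x) ⬝ᵥ R k *ᵥ (K k *ᵥ x)) := by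
      have h1 : euclNorm w ≤ b * euclNorm (K k *ᵥ x) + l * euclNorm (sqrtMat (Q k) *ᵥ x) :=
        (euclNorm_sub_le _ _).trans (add_le_add (hb _ _) (hl _ _))
      have h2 := ha k (K k *ᵥ x)
      have h3 := euclNorm_sqrtMat_sq (hQ k) x
      have h4 := pow_le_pow_left₀ (euclNorm_nonneg w) h1 2
      have h5 := quad_nonneg (hQ k) x
      have h6 := quad_nonneg (hR k).posSemidef (K k *ᵥ x)
      generalize euclNorm (K k *ᵥ x) = s at *
      generalize euclNorm (sqrtMat (Q k) *ᵥ x) = t at *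
      generalize x ⬝ᵥ Q k *ᵥ x = y at *
      generalize (K k *ᵥ x) ⬝ᵥ R k *ᵥ (K k *ᵥ x) = z at *
      calc euclNorm w ^ 2 ≤ 2 * (b ^ 2 * s ^ 2 + l ^ 2 * t ^ 2) := by
            nlinarith [sq_nonneg (b * s - l * t)]
        _ ≤ 2 * (b ^ 2 * (a * z) + l ^ 2 * y) := by rw [h3]; gcongr
        _ ≤ γ * (y + z) := by
          rw [hγ]
          have e1 : 0 ≤ b ^ 2 * a * y := by positivity
          have e2 : 0 ≤ l ^ 2 * z := by positivity
          nlinarith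
    have h1 : ν (k + 1) (closedLoop A B K k *ᵥ x) ≤ r * ν k x + c * euclNorm w := by
      rw [hx]
      exact (hν3 _ _ _).trans (add_le_add (hν4 _ _) (hν2 _ _))
    have h2 := pow_le_pow_left₀ (hν0 _ _) h1 2
    -- Convexity of the square with weights r and 1 - r, applied to ν and c|w|/(1 - r).
    have h3 : (r * ν k x + c * euclNorm w) ^ 2 ≤
        r * ν k x ^ 2 + c ^ 2 * euclNorm w ^ 2 / (1 - r) := by
      rw [← sub_nonneg]
      have : r * ν k x ^ 2 + c ^ 2 * euclNorm w ^ 2 / (1 - r) - (r * ν k x + c * euclNorm w) ^ 2 =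
        r * ((1 - r) * ν k x - c * euclNorm w) ^ 2 / (1 - r) := by
        field_simp
        ring
      rw [this]
      positivity
    have h4 : c ^ 2 * euclNorm w ^ 2 / (1 - r) ≤
        β * (x ⬝ᵥ Q k *ᵥ x + (K k *ᵥ x) ⬝ᵥ R k *ᵥ (K k *ᵥ x)) := by
      rw [hβ, div_mul_eq_mul_div, mul_assoc]
      exact div_le_div_of_nonneg_right (mul_le_mul_of_nonneg_left hw2 (sq_nonneg c)) hr1'.le
    linarith
  have hD : 0 < 1 + β * p := by positivity
  have hθ : 0 < (1 - r) / (1 + β * p) := div_pos hr1' hD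
  have hθ1 : (1 - r) / (1 + β * p) < 1 := by
    rw [div_lt_one hD]
    have : 0 ≤ β * p := by positivity
    linarith
  -- Adding β xᵀ P x cancels the stage cost in `hstep`, so the sum drops by at least (1 - r) ν².
  -- Since the sum is at most (1 + β p) ν², this is a contraction by the stated factor.
  refine expStable_of_lyapunov (fun k x => ν k x ^ 2 + β * (x ⬝ᵥ P k *ᵥ x))
    (c := c ^ 2 + β * p) (q := 1 - (1 - r) / (1 + β * p)) (by positivity) (by linarith)
    (by linarith) (fun k x => ?_) (fun k x => ?_) fun k x => ?_
  · have h1 := pow_le_pow_left₀ (euclNorm_nonneg x) (hν1 k x) 2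
    have h2 := mul_nonneg hβ0 (quad_nonneg (hP k) x)
    linarith
  · have h1 := pow_le_pow_left₀ (hν0 k x) (hν2 k x) 2
    have h2 := mul_le_mul_of_nonneg_left (hp k x) hβ0
    nlinarith
  · have h1 := hstep k x
    have h2 := hlyap' k x
    have h3 := mul_le_mul_of_nonneg_left (hp k x) hβ0
    have h4 := pow_le_pow_left₀ (euclNorm_nonneg x) (hν1 k x) 2
    have h5 := mul_le_mul_of_nonneg_left h4 (mul_nonneg hβ0 hp0)
    have h6 : (1 - r) / (1 + β * p) * (ν k x ^ 2 + β * (x ⬝ᵥ P k *ᵥ x)) ≤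
        (1 - r) * ν k x ^ 2 := by
      have h7 : ν k x ^ 2 + β * (x ⬝ᵥ P k *ᵥ x) ≤ (1 + β * p) * ν k x ^ 2 := by nlinarith
      refine (mul_le_mul_of_nonneg_left h7 hθ.le).trans (le_of_eq ?_)
      field_simp
    nlinarith

/-! ### Transition matrices and the periodic covariance. -/

/-- The transition matrix from time `k` to time `k + i`. -/
def transition (F : ℕ → Matrix (Fin n) (Fin n) ℝ) (k : ℕ) : ℕ → Matrix (Fin n) (Fin n) ℝ
  | 0 => 1
  | i + 1 => F (k + i) * transition F k i

theorem freeState_eq_transition (F : ℕ → Matrix (Fin n) (Fin n) ℝ) (k : ℕ) (x : Fin n → ℝ)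
    (i : ℕ) : freeState F k x i = transition F k i *ᵥ x := by
  induction i with
  | zero => simp [freeState, transition]
  | succ i ih => rw [freeState, ih, transition, mulVec_mulVec]

theorem ExpStable.exists_transition_le {F : ℕ → Matrix (Fin n) (Fin n) ℝ} (h : ExpStable F) :
    ∃ c r : ℝ, 0 < r ∧ r < 1 ∧ ∀ k i a b, |transition F k i a b| ≤ c * r ^ i := by
  obtain ⟨c, r, hc, hr0, hr1, hst⟩ := h
  refine ⟨c, r, hr0, hr1, fun k i a b => ?_⟩
  have h1 := (abs_apply_le_euclNorm _ a).trans (hst k (Pi.single b 1) i)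
  rw [freeState_eq_transition] at h1
  simpa using h1

/-- The covariance recursion of `x(k+1) = F(k) x(k) + w(k)` with unit noise and zero initial
covariance. -/
def covariance (F : ℕ → Matrix (Fin n) (Fin n) ℝ) : ℕ → Matrix (Fin n) (Fin n) ℝ
  | 0 => 0
  | k + 1 => 1 + F k * covariance F k * (F k)ᵀ

theorem covariance_posSemidef (F : ℕ → Matrix (Fin n) (Fin n) ℝ) (k : ℕ) :
    (covariance F k).PosSemidef := by
  induction k with
  | zero => exact .zero
  | succ k ih => exact PosSemidef.one.add (posSemidef_conj' ih _)

/-- Variation of constants: the i-th term is the noise that entered as state at time k - i,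
transported to time k. -/
theorem covariance_eq_sum (F : ℕ → Matrix (Fin n) (Fin n) ℝ) (k : ℕ) :
    covariance F k = ∑ i ∈ Finset.range k,
      transition F (k - i) i * (transition F (k - i) i)ᵀ := by
  induction k with
  | zero => simp [covariance]
  | succ k ih =>
    rw [covariance, ih, Finset.sum_range_succ', add_comm, Matrix.mul_sum, Matrix.sum_mul]
    congr 1
    · refine Finset.sum_congr rfl fun i hi => ?_
      have : k + 1 - (i + 1) + i = k := by have := Finset.mem_range.1 hi; omega
      rw [transition, this, Nat.add_sub_add_right, transpose_mul]
      simp only [Matrix.mul_assoc]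
    · simp [transition]

theorem ExpStable.covariance_bounded {F : ℕ → Matrix (Fin n) (Fin n) ℝ} (h : ExpStable F) :
    BoundedSeq (covariance F) := by
  obtain ⟨c, r, hr0, hr1, hle⟩ := h.exists_transition_le
  have hr2 : r ^ 2 < 1 := by nlinarith
  refine ⟨n * c ^ 2 * (1 - r ^ 2)⁻¹, fun k a b => ?_⟩
  rw [covariance_eq_sum, Matrix.sum_apply]
  calc _ ≤ ∑ i ∈ Finset.range k, |(transition F (k - i) i * (transition F (k - i) i)ᵀ) a b| :=
        Finset.abs_sum_le_sum_abs _ _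
    _ ≤ ∑ i ∈ Finset.range k, n * c ^ 2 * (r ^ 2) ^ i := by
        refine Finset.sum_le_sum fun i _ => ?_
        rw [Matrix.mul_apply]
        calc _ ≤ ∑ j, |transition F (k - i) i a j * (transition F (k - i) i)ᵀ j b| :=
              Finset.abs_sum_le_sum_abs _ _
          _ ≤ ∑ _j : Fin n, (c * r ^ i) * (c * r ^ i) := by
              refine Finset.sum_le_sum fun j _ => ?_
              rw [abs_mul]
              exact mul_le_mul (hle _ _ _ _) (hle _ _ _ _) (abs_nonneg _)
                ((abs_nonneg _).trans (hle (k - i) i a j))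
          _ = _ := by
              rw [Finset.sum_const, Finset.card_univ, Fintype.card_fin, nsmul_eq_mul]
              ring
    _ ≤ _ := by
        rw [← Finset.mul_sum]
        refine mul_le_mul_of_nonneg_left ?_ (by positivity)
        rw [← tsum_geometric_of_lt_one (sq_nonneg r) hr2]
        exact (summable_geometric_of_lt_one (sq_nonneg r) hr2).sum_le_tsum _
          fun i _ => by positivity

/-- A stable periodic system has a periodic covariance sequence. -/
theorem ExpStable.exists_periodic_covariance {F : ℕ → Matrix (Fin n) (Fin n) ℝ} {φ : ℕ}
    (h : ExpStable F) (hF : PeriodicSeq φ F) :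
    ∃ S : ℕ → Matrix (Fin n) (Fin n) ℝ, PeriodicSeq φ S ∧ (∀ k, (S k).PosSemidef) ∧
      ∀ k, S (k + 1) = 1 + F k * S k * (F k)ᵀ := by
  -- Starting from zero, a shift by one period can only increase the covariance; hence the limits
  -- along k + jφ exist and are periodic.
  have hmono : ∀ k, (covariance F (k + φ) - covariance F k).PosSemidef := by
    intro k
    induction k with
    | zero => simpa [covariance] using covariance_posSemidef F φ
    | succ k ih =>
      have : covariance F (k + 1 + φ) - covariance F (k + 1) =
          F k * (covariance F (k + φ) - covariance F k) * (F k)ᵀ := by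
        rw [Nat.add_right_comm, covariance, covariance, hF k, Matrix.mul_sub, Matrix.sub_mul]
        abel
      rw [this]
      exact posSemidef_conj' ih _
  obtain ⟨b, hb0, hb⟩ := h.covariance_bounded.exists_quad_le
  have hex : ∀ k, ∃ S, Tendsto (fun j => covariance F (k + j * φ)) atTop (𝓝 S) := by
    intro k
    refine exists_tendsto_of_monotone _
      (fun j => transpose_eq_of_posSemidef (covariance_posSemidef F _)) (fun j => ?_)
      fun x => ⟨b * euclNorm x ^ 2, fun j => hb _ _⟩
    rw [Nat.succ_mul, ← Nat.add_assoc]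
    exact hmono _
  choose S hS using hex
  refine ⟨S, fun k => ?_, fun k => posSemidef_of_tendsto (hS k) fun j =>
    covariance_posSemidef F _, fun k => ?_⟩
  · refine tendsto_nhds_unique (hS (k + φ)) (((hS k).comp (tendsto_add_atTop_nat 1)).congr
      fun j => ?_)
    simp only [Function.comp_apply]
    congr 1
    ring
  · have h1 : Tendsto (fun j => 1 + F k * covariance F (k + j * φ) * (F k)ᵀ) atTop
        (𝓝 (1 + F k * S k * (F k)ᵀ)) :=
      ((by fun_prop : Continuous fun N : Matrix (Fin n) (Fin n) ℝ =>
        1 + F k * N * (F k)ᵀ).tendsto (S k)).comp (hS k)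
    refine tendsto_nhds_unique (hS (k + 1)) (h1.congr fun j => ?_)
    rw [Nat.add_right_comm, covariance, hF.add_mul]

end Stability

/-! ### The semidefinite programme: data representation, lower bound, attainment. -/

section SDP

variable {n m L : ℕ}

/-- Full row rank makes the stacked data matrix surjective, so any prescribed pair of products is
solved column by column. -/
theorem exists_mul_eq_of_rank {X : Matrix (Fin n) (Fin L) ℝ} {U : Matrix (Fin m) (Fin L) ℝ}
    (h : (fromRows X U).rank = n + m) {p : ℕ} (Y : Matrix (Fin n) (Fin p) ℝ)
    (V : Matrix (Fin m) (Fin p) ℝ) : ∃ H : Matrix (Fin L) (Fin p) ℝ, X * H = Y ∧ U * H = V := by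
  have hs : LinearMap.range (fromRows X U).mulVecLin = ⊤ := by
    apply Submodule.eq_top_of_finrank_eq
    rw [← Matrix.rank, h]
    simp
  have hs' := LinearMap.range_eq_top.1 hs
  choose g hg using fun j => hs' ((fromRows Y V).col j)
  have hH : fromRows X U * (Matrix.of g)ᵀ = fromRows Y V := by
    ext i j
    exact congrFun (hg j) i
  rw [fromRows_mul, fromRows_ext_iff] at hH
  exact ⟨_, hH⟩

theorem dataMatrix_succ {A : Matrix (Fin n) (Fin n) ℝ} {B : Matrix (Fin n) (Fin m) ℝ}
    {xd : Fin L → ℕ → Fin n → ℝ} {ud : Fin L → ℕ → Fin m → ℝ} {k : ℕ}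
    (h : ∀ j, xd j (k + 1) = A *ᵥ xd j k + B *ᵥ ud j k) :
    dataMatrix xd (k + 1) = A * dataMatrix xd k + B * dataMatrix ud k := by
  ext i j
  exact congrFun (h j) i

theorem posSemidef_fromBlocks_iff {p q : ℕ} {T : Matrix (Fin p) (Fin p) ℝ}
    {M : Matrix (Fin p) (Fin q) ℝ} {S : Matrix (Fin q) (Fin q) ℝ} (hS : S.PosDef) :
    (fromBlocks T M Mᵀ S).PosSemidef ↔ (T - M * S⁻¹ * Mᵀ).PosSemidef := by
  have := hS.isUnit.invertible
  simpa using PosDef.fromBlocks₂₂ T M hS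

theorem mul_mul_inv_mul_transpose {p q : ℕ} (F : Matrix (Fin p) (Fin q) ℝ)
    {S : Matrix (Fin q) (Fin q) ℝ} (hS : S.PosDef) :
    F * S * S⁻¹ * (F * S)ᵀ = F * S * Fᵀ := by
  have hu := (isUnit_iff_isUnit_det _).1 hS.isUnit
  rw [Matrix.mul_assoc F, mul_nonsing_inv _ hu, Matrix.mul_one, transpose_mul,
    transpose_eq_of_posSemidef hS.posSemidef, Matrix.mul_assoc]

theorem posDef_of_sub_one {S : Matrix (Fin n) (Fin n) ℝ} (h : (S - 1).PosSemidef) :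
    S.PosDef := by
  simpa using PosDef.one.add_posSemidef h

section Feasible

variable {φ : ℕ} {X : ℕ → Matrix (Fin n) (Fin L) ℝ} {U : ℕ → Matrix (Fin m) (Fin L) ℝ}
  {A : ℕ → Matrix (Fin n) (Fin n) ℝ} {B : ℕ → Matrix (Fin n) (Fin m) ℝ}
  {Q : ℕ → Matrix (Fin n) (Fin n) ℝ} {R : ℕ → Matrix (Fin m) (Fin m) ℝ}
  {S : ℕ → Matrix (Fin n) (Fin n) ℝ} {H : ℕ → Matrix (Fin L) (Fin n) ℝ}
  {O : ℕ → Matrix (Fin m) (Fin m) ℝ} {P : ℕ → Matrix (Fin n) (Fin n) ℝ}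

/-- For k > 0 this is the upper left block of the constraint at k - 1; k = 0 has its own constraint.
-/
theorem SDPFeasible.sub_one_posSemidef (h : SDPFeasible φ X U R S H O) {k : ℕ} (hk : k ≤ φ) :
    (S k - 1).PosSemidef := by
  cases k with
  | zero => exact h.init
  | succ k => exact (h.dyn k hk).submatrix Sum.inl

theorem SDPFeasible.posDef (h : SDPFeasible φ X U R S H O) {k : ℕ} (hk : k ≤ φ) :
    (S k).PosDef :=
  posDef_of_sub_one (h.sub_one_posSemidef hk)

theorem trace_conj_mul {p q : ℕ} (M : Matrix (Fin p) (Fin p) ℝ) (C : Matrix (Fin p) (Fin q) ℝ)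
    (T : Matrix (Fin q) (Fin q) ℝ) : (Cᵀ * M * C * T).trace = (M * (C * T * Cᵀ)).trace := by
  rw [Matrix.mul_assoc, Matrix.mul_assoc, trace_mul_comm]
  simp only [Matrix.mul_assoc]

/-- The contribution of one time step to the objective is bounded below through the Riccati
equation. -/
theorem SDPFeasible.step_le (h : SDPFeasible φ X U R S H O)
    (hX : ∀ k < φ, X (k + 1) = A k * X k + B k * U k) (hRpos : ∀ k, (R k).PosDef)
    (hP : ∀ k, (P k).PosSemidef)
    (hric : ∀ k, P k = riccati (A k) (B k) (Q k) (R k) (P (k + 1))) {k : ℕ} (hk : k < φ) :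
    (P (k + 1)).trace + ((P k * S k).trace - (P (k + 1) * S (k + 1)).trace) +
      ((U k * H k * (S k)⁻¹ - riccatiGainSeq A B R P k)ᵀ *
        inputWeight (B k) (R k) (P (k + 1)) *
        (U k * H k * (S k)⁻¹ - riccatiGainSeq A B R P k)).trace ≤
      (Q k * S k).trace + (O k).trace := by
  have hS := h.posDef hk.le
  have hu := (isUnit_iff_isUnit_det _).1 hS.isUnit
  obtain ⟨K, hK⟩ : ∃ K, K = U k * H k * (S k)⁻¹ := ⟨_, rfl⟩
  have hKS : U k * H k = K * S k := by
    rw [hK, Matrix.mul_assoc (U k * H k), nonsing_inv_mul _ hu, Matrix.mul_one]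
  have hM : X (k + 1) * H k = (A k + B k * K) * S k := by
    rw [hX k hk, Matrix.add_mul, Matrix.add_mul, Matrix.mul_assoc, Matrix.mul_assoc, hKS,
      ← h.eq k hk, Matrix.mul_assoc]
  have hdyn := h.dyn k hk
  rw [← transpose_mul, hM, posSemidef_fromBlocks_iff hS, mul_mul_inv_mul_transpose _ hS] at hdyn
  have hslack := h.slack k hk
  have hN : sqrtMat (R k) * U k * H k = sqrtMat (R k) * K * S k := by
    rw [Matrix.mul_assoc, hKS, Matrix.mul_assoc]
  have hNt : (H k)ᵀ * (U k)ᵀ * sqrtMat (R k) = (sqrtMat (R k) * U k * H k)ᵀ := by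
    rw [transpose_mul, transpose_mul, sqrtMat_transpose, Matrix.mul_assoc]
  rw [hNt, hN, posSemidef_fromBlocks_iff hS, mul_mul_inv_mul_transpose _ hS] at hslack
  have t1 := hslack.trace_nonneg
  have e1 : (sqrtMat (R k) * K * S k * (sqrtMat (R k) * K)ᵀ).trace =
      (Kᵀ * R k * K * S k).trace := by
    have := trace_conj_mul 1 (sqrtMat (R k) * K) (S k)
    rw [Matrix.one_mul] at this
    rw [← this, transpose_mul, sqrtMat_transpose, Matrix.mul_one, Matrix.mul_assoc Kᵀ,
      ← Matrix.mul_assoc (sqrtMat (R k)), sqrtMat_mul_self (hRpos k).posSemidef,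
      ← Matrix.mul_assoc]
  rw [trace_sub, e1] at t1
  -- P(k+1) is the dual multiplier of the covariance inequality.
  have t2 := trace_mul_nonneg (hP (k + 1)) hdyn
  rw [Matrix.mul_sub, Matrix.mul_sub, trace_sub, trace_sub, Matrix.mul_one,
    ← trace_conj_mul] at t2
  have hs := stepCost_eq (A k) (B k) (Q := Q k) (hRpos k) (hP (k + 1)) K
  rw [← hric k] at hs
  change stepCost _ _ _ _ _ K = P k + (K - riccatiGainSeq A B R P k)ᵀ * _ *
    (K - riccatiGainSeq A B R P k) at hs
  rw [← hK]
  have hD := posSemidef_conj (inputWeight_posDef (B k) (hRpos k) (hP (k + 1))).posSemidef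
    (K - riccatiGainSeq A B R P k)
  -- S(k) ⪰ I removes S(k) from the penalty, leaving the plain trace of the square.
  have t3 := trace_mul_nonneg hD (h.sub_one_posSemidef hk.le)
  rw [Matrix.mul_sub, trace_sub, Matrix.mul_one] at t3
  have t4 := congrArg (fun M => (M * S k).trace) hs
  simp only [stepCost, Matrix.add_mul _ _ (S k), trace_add] at t4
  linarith

/-- The differences tr(P S) telescope and cancel over a period, since both P and S return to their
initial values. -/
theorem SDPFeasible.objective_ge (h : SDPFeasible φ X U R S H O)
    (hX : ∀ k < φ, X (k + 1) = A k * X k + B k * U k) (hRpos : ∀ k, (R k).PosDef)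
    (hP : ∀ k, (P k).PosSemidef) (hPφ : P φ = P 0)
    (hric : ∀ k, P k = riccati (A k) (B k) (Q k) (R k) (P (k + 1))) :
    ∑ k ∈ Finset.range φ, (P (k + 1)).trace + ∑ k ∈ Finset.range φ,
      ((U k * H k * (S k)⁻¹ - riccatiGainSeq A B R P k)ᵀ *
        inputWeight (B k) (R k) (P (k + 1)) *
        (U k * H k * (S k)⁻¹ - riccatiGainSeq A B R P k)).trace ≤ sdpObjective φ Q S O := by
  have h1 := Finset.sum_le_sum fun k (hk : k ∈ Finset.range φ) =>
    h.step_le (Q := Q) hX hRpos hP hric (Finset.mem_range.1 hk)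
  rw [Finset.sum_add_distrib, Finset.sum_add_distrib,
    Finset.sum_range_sub' (fun k => (P k * S k).trace), hPφ, h.periodic, sub_self, add_zero] at h1
  exact h1

/-- The Riccati gain yields a feasible point which attains the lower bound for the objective. -/
theorem exists_sdpFeasible (hφ : 0 < φ)
    (hX : ∀ k < φ, X (k + 1) = A k * X k + B k * U k)
    (hrank : ∀ k < φ, (fromRows (X k) (U k)).rank = n + m)
    (hA : PeriodicSeq φ A) (hB : PeriodicSeq φ B) (hR : PeriodicSeq φ R)
    (hRpos : ∀ k, (R k).PosDef) (hPper : PeriodicSeq φ P)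
    (hric : ∀ k, P k = riccati (A k) (B k) (Q k) (R k) (P (k + 1)))
    (hst : ExpStable (closedLoop A B (riccatiGainSeq A B R P))) :
    ∃ S H O, SDPFeasible φ X U R S H O ∧
      sdpObjective φ Q S O = ∑ k ∈ Finset.range φ, (P (k + 1)).trace := by
  have hF : PeriodicSeq φ (closedLoop A B (riccatiGainSeq A B R P)) := by
    intro k
    simp only [closedLoop, riccatiGainSeq, hA k, hB k, hR k, Nat.add_right_comm k φ 1,
      hPper (k + 1)]
  obtain ⟨S, hSper, hSpos, hS⟩ := hst.exists_periodic_covariance hF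
  set G := riccatiGainSeq A B R P with hG
  have hS1 : ∀ k, (S k - 1).PosSemidef := by
    intro k
    -- The recursion speaks only of successors, so k is moved forward by one period, which covers k
    -- = 0.
    rw [← hSper k, show k + φ = k + φ - 1 + 1 by omega, hS, add_sub_cancel_left]
    exact posSemidef_conj' (hSpos _) _
  have hSd : ∀ k, (S k).PosDef := fun k => posDef_of_sub_one (hS1 k)
  have hH : ∀ k, ∃ H : Matrix (Fin L) (Fin n) ℝ, k < φ → X k * H = S k ∧ U k * H = G k * S k := by
    intro k
    by_cases hk : k < φ
    · obtain ⟨H, hH⟩ := exists_mul_eq_of_rank (hrank k hk) (S k) (G k * S k)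
      exact ⟨H, fun _ => hH⟩
    · exact ⟨0, fun h => absurd h hk⟩
  choose H hH using hH
  -- This slack makes its Schur complement zero, and the covariance recursion does the same for the
  -- dynamics: no inequality in the lower bound loses anything.
  refine ⟨S, H, fun k => sqrtMat (R k) * G k * S k * (sqrtMat (R k) * G k)ᵀ,
    ⟨hS1 0, fun k hk => ?_, fun k hk => ?_, fun k hk => (hH k hk).1.symm, ?_⟩, ?_⟩
  · have hM : X (k + 1) * H k = closedLoop A B G k * S k := by
      rw [hX k hk, closedLoop, Matrix.add_mul, Matrix.add_mul, Matrix.mul_assoc,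
        Matrix.mul_assoc, (hH k hk).1, (hH k hk).2, Matrix.mul_assoc]
    rw [← transpose_mul, hM, posSemidef_fromBlocks_iff (hSd k),
      mul_mul_inv_mul_transpose _ (hSd k), hS, add_sub_cancel_left, sub_self]
    exact .zero
  · have hN : sqrtMat (R k) * U k * H k = sqrtMat (R k) * G k * S k := by
      rw [Matrix.mul_assoc, (hH k hk).2, Matrix.mul_assoc]
    have hNt : (H k)ᵀ * (U k)ᵀ * sqrtMat (R k) = (sqrtMat (R k) * U k * H k)ᵀ := by
      rw [transpose_mul, transpose_mul, sqrtMat_transpose, Matrix.mul_assoc]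
    rw [hNt, hN, posSemidef_fromBlocks_iff (hSd k), mul_mul_inv_mul_transpose _ (hSd k), sub_self]
    exact .zero
  · simpa using hSper 0
  · have hstep : ∀ k, (Q k * S k).trace +
        (sqrtMat (R k) * G k * S k * (sqrtMat (R k) * G k)ᵀ).trace =
        (P (k + 1)).trace + ((P k * S k).trace - (P (k + 1) * S (k + 1)).trace) := by
      intro k
      have e1 := trace_conj_mul 1 (sqrtMat (R k) * G k) (S k)
      rw [Matrix.one_mul, transpose_mul, sqrtMat_transpose, Matrix.mul_one,
        Matrix.mul_assoc (G k)ᵀ, ← Matrix.mul_assoc (sqrtMat (R k)),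
        sqrtMat_mul_self (hRpos k).posSemidef, ← Matrix.mul_assoc] at e1
      have e2 := trace_conj_mul (P (k + 1)) (closedLoop A B G k) (S k)
      have e3 : (P k * S k).trace = (Q k * S k).trace + ((G k)ᵀ * R k * G k * S k).trace +
          ((closedLoop A B G k)ᵀ * P (k + 1) * closedLoop A B G k * S k).trace := by
        conv_lhs => rw [hric k, riccati, stepCost, Matrix.add_mul _ _ (S k),
          Matrix.add_mul _ _ (S k), trace_add, trace_add]
        rfl
      rw [hS, Matrix.mul_add, trace_add, Matrix.mul_one, transpose_mul, sqrtMat_transpose, ← e1]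
      linarith
    have hPφ : P φ = P 0 := by simpa using hPper 0
    have hSφ : S φ = S 0 := by simpa using hSper 0
    rw [sdpObjective, Finset.sum_congr rfl fun k _ => hstep k, Finset.sum_add_distrib,
      Finset.sum_range_sub' (fun k => (P k * S k).trace), hPφ, hSφ, sub_self, add_zero]

end Feasible

theorem eq_zero_of_trace_conj {W : Matrix (Fin m) (Fin m) ℝ} (hW : W.PosDef)
    {D : Matrix (Fin m) (Fin n) ℝ} (h : (Dᵀ * W * D).trace = 0) : D = 0 := by
  have h1 := (posSemidef_conj hW.posSemidef D).trace_eq_zero_iff.1 h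
  refine Matrix.ext_of_mulVec_single fun i => ?_
  rw [zero_mulVec]
  by_contra hne
  have h2 := hW.dotProduct_mulVec_pos hne
  rw [star_trivial, ← quad_transpose_mul_mul, h1] at h2
  simp at h2

end SDP

end LTV

/-! ### The main theorem. -/

theorem corollary5 {n m L φ : ℕ} (hφ : 0 < φ)
    -- the periodic system
    (A : ℕ → Matrix (Fin n) (Fin n) ℝ) (B : ℕ → Matrix (Fin n) (Fin m) ℝ)
    (hA : LTV.PeriodicSeq φ A) (hB : LTV.PeriodicSeq φ B)
    -- the periodic weights
    (Q : ℕ → Matrix (Fin n) (Fin n) ℝ) (R : ℕ → Matrix (Fin m) (Fin m) ℝ)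
    (hQ : LTV.PeriodicSeq φ Q) (hR : LTV.PeriodicSeq φ R)
    (hQpos : ∀ k, (Q k).PosSemidef) (hRpos : ∀ k, (R k).PosDef)
    -- the assumptions of the infinite-horizon LQR problem
    (hstab : LTV.Stabilisable A B) (hdet : LTV.Detectable A (fun k => LTV.sqrtMat (Q k)))
    -- the input-state data of `L` experiments over one period, and the rank condition
    (xd : Fin L → ℕ → Fin n → ℝ) (ud : Fin L → ℕ → Fin m → ℝ)
    (hdata : ∀ j, ∀ k < φ, xd j (k + 1) = A k *ᵥ xd j k + B k *ᵥ ud j k)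
    (hrank : ∀ k < φ,
      (Matrix.fromRows (LTV.dataMatrix xd k) (LTV.dataMatrix ud k)).rank = n + m) :
    (∃ S H O, LTV.IsSDPSolution φ (LTV.dataMatrix xd) (LTV.dataMatrix ud) Q R S H O) ∧
    ∀ S H O, LTV.IsSDPSolution φ (LTV.dataMatrix xd) (LTV.dataMatrix ud) Q R S H O →
      (∀ k ≤ φ, IsUnit (S k)) ∧
      ∃ K : ℕ → Matrix (Fin m) (Fin n) ℝ,
        (∀ k < φ, K k = LTV.dataMatrix ud k * H k * (S k)⁻¹) ∧
        (∀ k p : ℕ, K (k + p * φ) = K k) ∧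
        LTV.IsOptimalGain A B Q R K ∧
        ∀ K', LTV.IsOptimalGain A B Q R K' → K' = K := by
  have hX : ∀ k < φ, LTV.dataMatrix xd (k + 1) =
      A k * LTV.dataMatrix xd k + B k * LTV.dataMatrix ud k := fun k hk =>
    LTV.dataMatrix_succ fun j => hdata j k hk
  obtain ⟨P, hPper, hP, hric, hlow⟩ :=
    LTV.exists_riccati_solution hφ hA hB hQ hR hQpos hRpos hstab
  have hPb := LTV.PeriodicSeq.bounded hφ hPper
  have hPφ : P φ = P 0 := by simpa using hPper 0
  set G := LTV.riccatiGainSeq A B R P with hG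
  have hst : LTV.ExpStable (LTV.closedLoop A B G) :=
    LTV.expStable_closedLoop hQpos hRpos (LTV.PeriodicSeq.bounded hφ hB)
      (LTV.PeriodicSeq.exists_sq_le_quad hφ hR hRpos) hdet hPb hP hric
  have hopt := LTV.isOptimalGain_riccatiGainSeq hQpos hRpos hP hric hlow hst
  have hW : ∀ k, (LTV.inputWeight (B k) (R k) (P (k + 1))).PosDef := fun k =>
    LTV.inputWeight_posDef _ (hRpos k) (hP _)
  obtain ⟨S₀, H₀, O₀, hfeas, hval⟩ :=
    LTV.exists_sdpFeasible (Q := Q) hφ hX hrank hA hB hR hRpos hPper hric hst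
  refine ⟨⟨S₀, H₀, O₀, hfeas, fun S H O h => ?_⟩, fun S H O h => ?_⟩
  · rw [hval]
    refine le_trans ?_ (h.objective_ge (Q := Q) hX hRpos hP hPφ hric)
    exact le_add_of_nonneg_right (Finset.sum_nonneg fun k _ =>
      (LTV.posSemidef_conj (hW k).posSemidef _).trace_nonneg)
  · refine ⟨fun k hk => (h.1.posDef hk).isUnit, G, fun k hk => ?_, fun k p => ?_, hopt,
      fun K' hK' => hK'.eq_riccatiGainSeq hQpos hRpos hPb hP hric⟩
    -- The optimal value is squeezed between ∑ tr P(k+1) plus the penalties and ∑ tr P(k+1), so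
    -- every penalty is zero.
    · have h1 := h.1.objective_ge (Q := Q) hX hRpos hP hPφ hric
      have h2 := h.2 S₀ H₀ O₀ hfeas
      rw [hval] at h2
      have hnn := fun k => (LTV.posSemidef_conj (hW k).posSemidef
        (LTV.dataMatrix ud k * H k * (S k)⁻¹ - G k)).trace_nonneg
      have h3 := (Finset.sum_eq_zero_iff_of_nonneg fun k _ => hnn k).1
        (le_antisymm (by linarith) (Finset.sum_nonneg fun k _ => hnn k)) k (Finset.mem_range.2 hk)
      exact (sub_eq_zero.1 (LTV.eq_zero_of_trace_conj (hW k) h3)).symm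
    · refine LTV.PeriodicSeq.add_mul (fun k => ?_) k p
      simp only [hG, LTV.riccatiGainSeq, hA k, hB k, hR k, Nat.add_right_comm k φ 1,
        hPper (k + 1)]
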